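/- Let $G$ be a discrete group. A $G$-ring is an associative (not necessarily unital or commutative) ring $A$ with a group homomorphism $\alpha:G\to\mathrm{Aut}(A)$; it is quadratik if every element is a finite sum of products $ab$. A right functional $A$-module is a right $A$-module $\mathcal E$ with a compatible $G$-action ($g(\xi a)=g(\xi)\alpha_g(a)$) and a $G$-invariant left $A$-submodule $\Theta_A(\mathcal E)\subseteq \mathrm{Hom}_A(\mathcal E,A)$; $\mathcal L_A(\mathcal E)$ is the $G$-ring of the $A$-linear $V:\mathcal E\to\mathcal E$ with $\phi\circ V\in\Theta_A(\mathcal E)$ for all $\phi\in\Theta_A(\mathcal E)$; $\mathcal K_A(\mathcal E)$ is the $G$-ring of finite sums of the operators $\xi\mapsto\eta\,\phi(\xi)$ ($\eta\in\mathcal E$, $\phi\in\Theta_A(\mathcal E)$); $\mathcal E$ is cofull if it is additively spanned by the elements $\xi\phi(\eta)$. A quadratik ring $A$ is a functional module over itself, with $\Theta_A(A)=A$ acting by left multiplication. Let $\mathcal R^G$ be a class of quadratik $G$-rings, taken as a category with all $G$-equivariant ring homomorphisms (written simply "ring homomorphisms" below), which is closed under direct sums, $A\mapsto A[0,1]:=A\otimes_{\mathbb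 Z} C([0,1],\mathbb C)$, compact operators $\mathcal K_A(\mathcal E)$ and adjointable operators $\mathcal L_A(\mathcal E)$ of cofull modules $\mathcal E$, and under $M\,\square_s A:=\{(s(a)+i(b),a)\}\subseteq M\oplus A$ for ring homomorphisms $s:A\to M$ and $i:B\to M$, $i$ injective with image a two-sided ideal. Let $GK^G$ be the category whose objects are the rings in $\mathcal R^G$ and whose morphisms are generated, under composition, addition and subtraction, by * all ring homomorphisms $f:A\to B$; * a morphism $e^{-1}:\mathcal K_A(\mathcal E\oplus \mathbb H_A)\to A$ for every corner embedding $e:A\to \mathcal K_A(\mathcal E\oplus \mathbb H_A)$, where $\mathcal E$ is a functional $A$-module, $\mathbb H_A=A\oplus\bigoplus_{J}A$ with the given action on the first summand and any action (leaving the functionals invariant) on the second, $\mathcal E\oplus\mathbb H_A$ is cofull, and $e(a)(\xi\oplus b\oplus\eta)=0\oplus ab\oplus 0$; * a morphism $\Delta_s:M\to B$ for every split exact sequence $0\to B\xrightarrow{j}M\xrightarrow{f}A\to0$ with split $s:A\to M$ in $\mathcal R^G$; subject to the laws of a category with abelian groups of morphisms and bilinear composition and to the following relations (compositions are written from left to right):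 composition and identities of ring homomorphisms are those of $\mathcal R^G$; $1_{A\oplus B}=p_Ai_A+p_Bi_B$; $f_0=f_1$ if $f_0,f_1:A\to B$ are homotopic, that is, if there is a ring homomorphism $A\to B[0,1]$ whose evaluations at $0$ and $1$ are $a\mapsto f_0(a)\otimes1$ and $a\mapsto f_1(a)\otimes 1$ in $B\otimes_{\mathbb Z}\mathbb C$; $ee^{-1}=1$ and $e^{-1}e=1$ for all corner embeddings $e$; $j\Delta_s=1_B$ and $\Delta_sj+fs=1_M$ for all split exact sequences. Let $L_0GK^G$ be the smallest additive subcategory of $GK^G$ (with all its objects) that contains all ring homomorphisms. **Theorem.** Let $F:GK^G\to D$ be any functor into a category $D$, not necessarily additive. Then $F$ is faithful if and only if its restriction to $L_0GK^G$ is faithful. -/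

import Mathlib

open CategoryTheory
open scoped TensorProduct

universe w u v₁ u₁

namespace GKTheory

/-! ### Rings with an action of a discrete group -/

/-- A `G`-ring `(A, α)`: an associative, not necessarily commutative or unital ring with a group
homomorphism `α : G → Aut(A)`. -/
structure GRing (G : Type w) [Group G] : Type (max w (u + 1)) where
  carrier : Type u
  [ring : NonUnitalRing carrier]
  act : G →* RingAut carrier

attribute [instance] GRing.ring

/-- A `G`-equivariant ring homomorphism. -/
structure GHom {G : Type w} [Group G] (A B : GRing.{w, u} G) : Type u where
  toHom : A.carrier →ₙ+* B.carrier
  map_act : ∀ (g : G) (a : A.carrier), toHom (A.act g a) = B.act g (toHom a)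

/-- A group homomorphism into the automorphism group, from a multiplicative family of ring
endomorphisms. -/
def actOfFamily {G : Type w} [Group G] {R : Type u} [NonUnitalRing R] (σ : G → R → R)
    (map_mul : ∀ g x y, σ g (x * y) = σ g x * σ g y)
    (map_add : ∀ g x y, σ g (x + y) = σ g x + σ g y)
    (h_one : ∀ x, σ 1 x = x) (h_mul : ∀ g h x, σ (g * h) x = σ g (σ h x)) : G →* RingAut R where
  toFun g :=
    { toFun := σ g
      invFun := σ g⁻¹
      left_inv := fun x => by rw [← h_mul, inv_mul_cancel, h_one]
      right_inv := fun x => by rw [← h_mul, mul_inv_cancel, h_one]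
      map_mul' := map_mul g
      map_add' := map_add g }
  map_one' := by
    ext x
    exact h_one x
  map_mul' g h := by
    ext x
    exact h_mul g h x

namespace GHom

variable {G : Type w} [Group G]

/-- The identity homomorphism. -/
def id (A : GRing.{w, u} G) : GHom A A where
  toHom := NonUnitalRingHom.id A.carrier
  map_act _ _ := rfl

/-- The composition `A → B → C`, written from left to right. -/
def comp {A B C : GRing.{w, u} G} (f : GHom A B) (g : GHom B C) : GHom A C where
  toHom := g.toHom.comp f.toHom
  map_act x a := by
    show g.toHom (f.toHom (A.act x a)) = C.act x (g.toHom (f.toHom a))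
    rw [f.map_act, g.map_act]

end GHom

namespace GRing

variable {G : Type w} [Group G]

/-- A ring is quadratik if every element is a finite sum of products. -/
def Quadratik (A : GRing.{w, u} G) : Prop :=
  AddSubgroup.closure {c : A.carrier | ∃ a b : A.carrier, c = a * b} = ⊤

/-- The direct sum `A ⊕ B` of two `G`-rings. -/
abbrev prod (A B : GRing.{w, u} G) : GRing.{w, u} G where
  carrier := A.carrier × B.carrier
  act := actOfFamily
    (fun g x => (A.act g x.1, B.act g x.2))
    (fun g x y => by simp)
    (fun g x y => by simp)
    (fun x => by simp)
    (fun g h x => by simp)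

/-- The projection `A ⊕ B → A`. -/
def fst (A B : GRing.{w, u} G) : GHom (prod A B) A where
  toHom := NonUnitalRingHom.fst A.carrier B.carrier
  map_act _ _ := rfl

/-- The projection `A ⊕ B → B`. -/
def snd (A B : GRing.{w, u} G) : GHom (prod A B) B where
  toHom := NonUnitalRingHom.snd A.carrier B.carrier
  map_act _ _ := rfl

/-- The injection `A → A ⊕ B`. -/
def inl (A B : GRing.{w, u} G) : GHom A (prod A B) where
  toHom :=
    { toFun := fun a => (a, 0)
      map_mul' := fun x y => by ext <;> simp
      map_zero' := rfl
      map_add' := fun x y => by ext <;> simp }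
  map_act g a := Prod.ext rfl (map_zero (B.act g)).symm

/-- The injection `B → A ⊕ B`. -/
def inr (A B : GRing.{w, u} G) : GHom B (prod A B) where
  toHom :=
    { toFun := fun b => (0, b)
      map_mul' := fun x y => by ext <;> simp
      map_zero' := rfl
      map_add' := fun x y => by ext <;> simp }
  map_act g b := Prod.ext (map_zero (A.act g)).symm rfl

/-- A `G`-invariant subring, with the restricted action. -/
abbrev sub (A : GRing.{w, u} G) (S : NonUnitalSubring A.carrier)
    (hS : ∀ (g : G), ∀ x ∈ S, A.act g x ∈ S) : GRing.{w, u} G where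
  carrier := S
  act := actOfFamily
    (fun g x => ⟨A.act g x.1, hS g x.1 x.2⟩)
    (fun g x y => Subtype.ext (by simp))
    (fun g x y => Subtype.ext (by simp))
    (fun x => Subtype.ext (by simp))
    (fun g h x => Subtype.ext (by simp))

/-- The subring `{(s(a) + i(b), a)}` of `M ⊕ A`, where the image of `i : B → M` is a two-sided
ideal of `M`. -/
def squareSubring {B M A : GRing.{w, u} G} (i : GHom B M) (s : GHom A M)
    (h_left : ∀ m b, ∃ b', m * i.toHom b = i.toHom b')
    (h_right : ∀ b m, ∃ b', i.toHom b * m = i.toHom b') :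
    NonUnitalSubring (M.carrier × A.carrier) where
  carrier := {x | ∃ b, x.1 = s.toHom x.2 + i.toHom b}
  zero_mem' := ⟨0, by simp⟩
  add_mem' := by
    rintro x y ⟨b, hb⟩ ⟨c, hc⟩
    refine ⟨b + c, ?_⟩
    simp only [Prod.fst_add, Prod.snd_add, hb, hc, map_add]
    abel
  neg_mem' := by
    rintro x ⟨b, hb⟩
    refine ⟨-b, ?_⟩
    simp only [Prod.fst_neg, Prod.snd_neg, hb, map_neg]
    abel
  mul_mem' := by
    rintro x y ⟨b, hb⟩ ⟨c, hc⟩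
    obtain ⟨p, hp⟩ := h_left (s.toHom x.2) c
    obtain ⟨q, hq⟩ := h_right b (s.toHom y.2)
    refine ⟨p + q + b * c, ?_⟩
    simp only [Prod.fst_mul, Prod.snd_mul, hb, hc, map_add, map_mul, ← hp, ← hq]
    noncomm_ring

/-- The `G`-ring `M □_s A = {(s(a) + i(b), a)} ⊆ M ⊕ A`. -/
abbrev square {B M A : GRing.{w, u} G} (i : GHom B M) (s : GHom A M)
    (h_left : ∀ m b, ∃ b', m * i.toHom b = i.toHom b')
    (h_right : ∀ b m, ∃ b', i.toHom b * m = i.toHom b') : GRing.{w, u} G :=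
  sub (prod M A) (squareSubring i s h_left h_right) (by
    rintro g x ⟨b, hb⟩
    refine ⟨B.act g b, ?_⟩
    show M.act g x.1 = s.toHom (A.act g x.2) + i.toHom (B.act g b)
    rw [s.map_act, i.map_act, ← map_add]
    exact congrArg (M.act g) hb)

/-- The ring structure of `B ⊗ R` (tensor product over `ℤ`), with
`(b ⊗ r) (b' ⊗ r') = b b' ⊗ r r'`. -/
noncomputable instance (B : GRing.{w, u} G) (R : Type) [CommRing R] :
    NonUnitalRing (B.carrier ⊗[ℤ] R) :=
  Algebra.TensorProduct.instNonUnitalRing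

/-- The map `β_g ⊗ id` on `B ⊗ R`. -/
noncomputable def tensorMap (B : GRing.{w, u} G) (R : Type) [CommRing R] (g : G) :
    B.carrier ⊗[ℤ] R →ₗ[ℤ] B.carrier ⊗[ℤ] R :=
  TensorProduct.map ((B.act g : B.carrier →+ B.carrier).toIntLinearMap) LinearMap.id

theorem tensorMap_tmul (B : GRing.{w, u} G) (R : Type) [CommRing R] (g : G) (b : B.carrier)
    (z : R) : B.tensorMap R g (b ⊗ₜ[ℤ] z) = (B.act g b) ⊗ₜ[ℤ] z := rfl

theorem tensorMap_mul (B : GRing.{w, u} G) (R : Type) [CommRing R] (g : G)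
    (x y : B.carrier ⊗[ℤ] R) :
    B.tensorMap R g (x * y) = B.tensorMap R g x * B.tensorMap R g y := by
  induction x using TensorProduct.induction_on with
  | zero => rw [zero_mul, map_zero, zero_mul]
  | add a b ha hb => rw [add_mul, map_add, map_add, ha, hb, add_mul]
  | tmul a p =>
    induction y using TensorProduct.induction_on with
    | zero => rw [mul_zero, map_zero, mul_zero]
    | add a b ha hb => rw [mul_add, map_add, map_add, ha, hb, mul_add]
    | tmul b q =>
      rw [Algebra.TensorProduct.tmul_mul_tmul, tensorMap_tmul, tensorMap_tmul, tensorMap_tmul,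
        Algebra.TensorProduct.tmul_mul_tmul, map_mul]

/-- The ring `B ⊗ R` (tensor product over `ℤ`) with the action `β ⊗ triv`. -/
noncomputable abbrev tensor (B : GRing.{w, u} G) (R : Type) [CommRing R] : GRing.{w, u} G where
  carrier := B.carrier ⊗[ℤ] R
  act := actOfFamily
    (fun g => B.tensorMap R g)
    (fun g => B.tensorMap_mul R g)
    (fun g => map_add (B.tensorMap R g))
    (fun x => by
      induction x using TensorProduct.induction_on with
      | zero => rw [map_zero]
      | add a b ha hb => rw [map_add, ha, hb]
      | tmul a p => rw [tensorMap_tmul, map_one, RingAut.one_apply])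
    (fun g h x => by
      induction x using TensorProduct.induction_on with
      | zero => simp only [map_zero]
      | add a b ha hb => simp only [map_add, ha, hb]
      | tmul a p => rw [tensorMap_tmul, tensorMap_tmul, tensorMap_tmul, map_mul,
          RingAut.mul_apply])

/-- The ring `B[0,1] = B ⊗ C([0,1], ℂ)`. -/
noncomputable abbrev cyl (B : GRing.{w, u} G) : GRing.{w, u} G :=
  B.tensor C(unitInterval, ℂ)

/-- The map `id ⊗ φ : B ⊗ R → B ⊗ S` for a ring homomorphism `φ : R → S`. -/
noncomputable def tensorRight (B : GRing.{w, u} G) {R S : Type} [CommRing R] [CommRing S]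
    (φ : R →+* S) : (B.tensor R).carrier →+ (B.tensor S).carrier :=
  (TensorProduct.map (LinearMap.id : B.carrier →ₗ[ℤ] B.carrier)
    φ.toAddMonoidHom.toIntLinearMap).toAddMonoidHom

/-- The evaluation `v_t : B ⊗ C([0,1], ℂ) → B ⊗ ℂ`, `b ⊗ z ↦ b ⊗ z(t)`. -/
noncomputable def evalAt (B : GRing.{w, u} G) (t : unitInterval) :
    B.cyl.carrier →+ (B.tensor ℂ).carrier :=
  B.tensorRight ((Pi.evalRingHom (fun _ : unitInterval => ℂ) t).comp ContinuousMap.coeFnRingHom)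

end GRing

/-- `f₀` and `f₁` are the endpoints of a homotopy `F : A → B[0,1]`: the endpoints of `F` in the
complexification `B ⊗ ℂ` come from `f₀, f₁ : A → B` via `b ↦ b ⊗ 1`. -/
def Homotopic {G : Type w} [Group G] {A B : GRing.{w, u} G} (f₀ f₁ : GHom A B) : Prop :=
  ∃ F : GHom A B.cyl, ∀ a : A.carrier,
    B.evalAt 0 (F.toHom a) = f₀.toHom a ⊗ₜ[ℤ] (1 : ℂ) ∧
    B.evalAt 1 (F.toHom a) = f₁.toHom a ⊗ₜ[ℤ] (1 : ℂ)

/-- A split exact sequence `0 → B → M → A → 0` of `G`-rings, with maps `j`, `f` and a split `s`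
of `f`. -/
structure SplitExact {G : Type w} [Group G] (B M A : GRing.{w, u} G) : Type u where
  j : GHom B M
  f : GHom M A
  s : GHom A M
  injective : Function.Injective j.toHom
  exact : ∀ m, f.toHom m = 0 ↔ ∃ b, j.toHom b = m
  split : ∀ a, f.toHom (s.toHom a) = a

/-! ### Functional modules -/

/-- A right functional `A`-module `(E, S, Θ_A(E))`: a right `A`-module `E` (with `smul ξ a = ξ a`),
a `G`-action `S` on it, and a `G`-invariant left `A`-submodule `Θ` of `Hom_A(E, A)`. -/
structure FModule {G : Type w} [Group G] (A : GRing.{w, u} G) : Type (max w (u + 1)) where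
  carrier : Type u
  [grp : AddCommGroup carrier]
  smul : carrier →+ A.carrier →+ carrier
  smul_mul : ∀ ξ a b, smul ξ (a * b) = smul (smul ξ a) b
  act : G →* AddMonoid.End carrier
  act_smul : ∀ g ξ a, act g (smul ξ a) = smul (act g ξ) (A.act g a)
  Θ : AddSubgroup (carrier →+ A.carrier)
  map_smul : ∀ φ ∈ Θ, ∀ ξ a, φ (smul ξ a) = φ ξ * a
  left_mem : ∀ a, ∀ φ ∈ Θ, (AddMonoidHom.mulLeft a).comp φ ∈ Θ
  act_mem : ∀ g, ∀ φ ∈ Θ,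
    (A.act g : A.carrier →+ A.carrier).comp (φ.comp (act g⁻¹ : carrier →+ carrier)) ∈ Θ

attribute [instance] FModule.grp

namespace FModule

variable {G : Type w} [Group G] {A : GRing.{w, u} G}

/-- `E` is cofull if it is spanned by the elements `ξ φ(η)`. -/
def Cofull (E : FModule A) : Prop :=
  AddSubgroup.closure {ζ : E.carrier | ∃ ξ η, ∃ φ ∈ E.Θ, ζ = E.smul ξ (φ η)} = ⊤

/-- The quadratik ring `A` as a functional module over itself; the functionals are the left
multiplications by elements of `A`. -/
abbrev self (A : GRing.{w, u} G) : FModule A where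
  carrier := A.carrier
  smul := AddMonoidHom.mul
  smul_mul ξ a b := (mul_assoc ξ a b).symm
  act :=
    { toFun := fun g => (A.act g : A.carrier →+ A.carrier)
      map_one' := AddMonoidHom.ext fun x => by
        show A.act 1 x = x
        rw [map_one, RingAut.one_apply]
      map_mul' := fun g h => AddMonoidHom.ext fun x => by
        show A.act (g * h) x = A.act g (A.act h x)
        rw [map_mul, RingAut.mul_apply] }
  act_smul g ξ a := map_mul (A.act g) ξ a
  Θ := (AddMonoidHom.mul : A.carrier →+ A.carrier →+ A.carrier).range
  map_smul := by
    rintro _ ⟨c, rfl⟩ ξ a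
    exact (mul_assoc c ξ a).symm
  left_mem := by
    rintro a _ ⟨c, rfl⟩
    refine ⟨a * c, ?_⟩
    ext x
    exact mul_assoc a c x
  act_mem := by
    rintro g _ ⟨c, rfl⟩
    refine ⟨A.act g c, AddMonoidHom.ext fun x => ?_⟩
    show A.act g c * x = A.act g (c * A.act g⁻¹ x)
    rw [map_mul, ← RingAut.mul_apply (A.act g) (A.act g⁻¹), ← map_mul, mul_inv_cancel, map_one,
      RingAut.one_apply]

/-- The direct sum of two functional modules, with functionals `φ ⊕ ψ` and diagonal action. -/
abbrev sum (E F : FModule A) : FModule A where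
  carrier := E.carrier × F.carrier
  smul :=
    { toFun := fun x => (E.smul x.1).prod (F.smul x.2)
      map_zero' := by
        ext a <;> simp
      map_add' := fun x y => by
        ext a <;> simp }
  smul_mul x a b := Prod.ext (E.smul_mul x.1 a b) (F.smul_mul x.2 a b)
  act :=
    { toFun := fun g =>
        ((E.act g : E.carrier →+ E.carrier).prodMap (F.act g : F.carrier →+ F.carrier) :
          E.carrier × F.carrier →+ E.carrier × F.carrier)
      map_one' := AddMonoidHom.ext fun x => by
        show (E.act 1 x.1, F.act 1 x.2) = x
        rw [map_one, map_one]
        rfl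
      map_mul' := fun g h => AddMonoidHom.ext fun x => by
        show (E.act (g * h) x.1, F.act (g * h) x.2) =
          (E.act g (E.act h x.1), F.act g (F.act h x.2))
        rw [map_mul, map_mul]
        rfl }
  act_smul g x a := Prod.ext (E.act_smul g x.1 a) (F.act_smul g x.2 a)
  Θ :=
    { carrier := {χ | ∃ φ ∈ E.Θ, ∃ ψ ∈ F.Θ, χ = φ.coprod ψ}
      zero_mem' := ⟨0, E.Θ.zero_mem, 0, F.Θ.zero_mem, by
        ext; simp⟩
      add_mem' := by
        rintro _ _ ⟨φ, hφ, ψ, hψ, rfl⟩ ⟨φ', hφ', ψ', hψ', rfl⟩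
        refine ⟨φ + φ', E.Θ.add_mem hφ hφ', ψ + ψ', F.Θ.add_mem hψ hψ',
          AddMonoidHom.ext fun x => ?_⟩
        show φ x.1 + ψ x.2 + (φ' x.1 + ψ' x.2) = φ x.1 + φ' x.1 + (ψ x.2 + ψ' x.2)
        abel
      neg_mem' := by
        rintro _ ⟨φ, hφ, ψ, hψ, rfl⟩
        refine ⟨-φ, E.Θ.neg_mem hφ, -ψ, F.Θ.neg_mem hψ, AddMonoidHom.ext fun x => ?_⟩
        show -(φ x.1 + ψ x.2) = -φ x.1 + -ψ x.2
        abel }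
  map_smul := by
    rintro _ ⟨φ, hφ, ψ, hψ, rfl⟩ x a
    simp [E.map_smul φ hφ, F.map_smul ψ hψ, add_mul]
  left_mem := by
    rintro a _ ⟨φ, hφ, ψ, hψ, rfl⟩
    refine ⟨_, E.left_mem a φ hφ, _, F.left_mem a ψ hψ, AddMonoidHom.ext fun x => ?_⟩
    exact mul_add a (φ x.1) (ψ x.2)
  act_mem := by
    rintro g _ ⟨φ, hφ, ψ, hψ, rfl⟩
    refine ⟨_, E.act_mem g φ hφ, _, F.act_mem g ψ hψ, AddMonoidHom.ext fun x => ?_⟩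
    exact map_add (A.act g) (φ (E.act g⁻¹ x.1)) (ψ (F.act g⁻¹ x.2))

/-- The right multiplication on `⨁_{j ∈ J} A`. -/
noncomputable def freeSmul (A : GRing.{w, u} G) (J : Type u) :
    (J →₀ A.carrier) →+ A.carrier →+ (J →₀ A.carrier) where
  toFun x :=
    { toFun := fun a => x.mapRange (fun b => b * a) (zero_mul a)
      map_zero' := by
        ext j
        simp
      map_add' := fun a b => by
        ext j
        simp [mul_add] }
  map_zero' := by
    ext a j
    simp
  map_add' x y := by
    ext a j
    simp [add_mul]

/-- The functional `⨁_j c_j` on `⨁_{j ∈ J} A`, sending `(b_j)` to `∑ c_j b_j`. -/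
noncomputable def freeFunctional (A : GRing.{w, u} G) (J : Type u) (c : J → A.carrier) :
    (J →₀ A.carrier) →+ A.carrier :=
  Finsupp.liftAddHom fun j => AddMonoidHom.mulLeft (c j)

/-- The direct sum `⨁_{j ∈ J} A` of copies of `A` with its direct sum functionals, and with an
arbitrary (not necessarily diagonal) `G`-action `T` leaving the functionals invariant. -/
noncomputable abbrev free (A : GRing.{w, u} G) (J : Type u)
    (T : G →* AddMonoid.End (J →₀ A.carrier))
    (hT : ∀ g x a, T g (freeSmul A J x a) = freeSmul A J (T g x) (A.act g a))
    (hΘ : ∀ g c, ∃ c', ∀ x,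
      A.act g (freeFunctional A J c (T g⁻¹ x)) = freeFunctional A J c' x) : FModule A where
  carrier := J →₀ A.carrier
  smul := freeSmul A J
  smul_mul x a b := by
    ext j
    exact (mul_assoc (x j) a b).symm
  act := T
  act_smul := hT
  Θ :=
    { carrier := Set.range (freeFunctional A J)
      zero_mem' := ⟨0, by
        ext
        simp [freeFunctional]⟩
      add_mem' := by
        rintro _ _ ⟨c, rfl⟩ ⟨d, rfl⟩
        refine ⟨c + d, ?_⟩
        ext
        simp [freeFunctional, add_mul]
      neg_mem' := by
        rintro _ ⟨c, rfl⟩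
        refine ⟨-c, ?_⟩
        ext
        simp [freeFunctional] }
  map_smul := by
    rintro _ ⟨c, rfl⟩ x a
    induction x using Finsupp.induction_linear with
    | zero => simp
    | add x y hx hy => simp only [map_add, AddMonoidHom.add_apply, hx, hy, add_mul]
    | single j b =>
      have h : freeSmul A J (Finsupp.single j b) a = Finsupp.single j (b * a) :=
        Finsupp.mapRange_single (hf := zero_mul a)
      rw [h]
      simp [freeFunctional, mul_assoc, -Finsupp.single_mul]
  left_mem := by
    rintro a _ ⟨c, rfl⟩
    refine ⟨fun j => a * c j, ?_⟩
    ext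
    simp [freeFunctional, mul_assoc]
  act_mem := by
    rintro g _ ⟨c, rfl⟩
    obtain ⟨c', hc'⟩ := hΘ g c
    exact ⟨c', AddMonoidHom.ext fun x => (hc' x).symm⟩

/-- The additive endomorphisms of `E` under composition, with the action `Ad(S)`. -/
abbrev endRing (E : FModule A) : GRing.{w, u} G where
  carrier := AddMonoid.End E.carrier
  act := actOfFamily
    (fun g T => E.act g * T * E.act g⁻¹)
    (fun g S T => by
      have h : E.act g⁻¹ * E.act g = 1 := by rw [← map_mul, inv_mul_cancel, map_one]
      calc E.act g * (S * T) * E.act g⁻¹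
          = E.act g * S * 1 * (T * E.act g⁻¹) := by simp only [mul_assoc, one_mul]
        _ = E.act g * S * (E.act g⁻¹ * E.act g) * (T * E.act g⁻¹) := by rw [h]
        _ = _ := by simp only [mul_assoc])
    (fun g S T => by rw [mul_add, add_mul])
    (fun T => by simp)
    (fun g h T => by simp [mul_assoc])

/-- The elementary compact operator `θ_{η,φ}(ξ) = η φ(ξ)`. -/
def theta (E : FModule A) (η : E.carrier) (φ : E.carrier →+ A.carrier) :
    AddMonoid.End E.carrier :=
  (E.smul η).comp φ

/-- The set of elementary compact operators. -/
def elementary (E : FModule A) : Set (AddMonoid.End E.carrier) :=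
  {T | ∃ η, ∃ φ ∈ E.Θ, T = E.theta η φ}

/-- The compact operators of `E`: the finite sums of elementary ones. -/
def compactSubring (E : FModule A) : NonUnitalSubring (AddMonoid.End E.carrier) :=
  { AddSubgroup.closure E.elementary with
    mul_mem' := by
      intro S T hS hT
      change S ∈ AddSubgroup.closure E.elementary at hS
      change T ∈ AddSubgroup.closure E.elementary at hT
      change S * T ∈ AddSubgroup.closure E.elementary
      induction hS, hT using AddSubgroup.closure_induction₂ with
      | mem S T hS hT =>
        obtain ⟨ξ, φ, hφ, rfl⟩ := hS
        obtain ⟨η, ψ, hψ, rfl⟩ := hT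
        refine AddSubgroup.subset_closure ⟨E.smul ξ (φ η), ψ, hψ, AddMonoidHom.ext fun x => ?_⟩
        show E.smul ξ (φ (E.smul η (ψ x))) = E.smul (E.smul ξ (φ η)) (ψ x)
        rw [E.map_smul φ hφ, E.smul_mul]
      | zero_left x _ => rw [zero_mul]; exact zero_mem _
      | zero_right x _ => rw [mul_zero]; exact zero_mem _
      | add_left x y z _ _ _ hx hy => rw [add_mul]; exact add_mem hx hy
      | add_right x y z _ _ _ hx hy => rw [mul_add]; exact add_mem hx hy
      | neg_left x y _ _ h => rw [neg_mul]; exact neg_mem h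
      | neg_right x y _ _ h => rw [mul_neg]; exact neg_mem h }

/-- The `G`-ring `K_A(E)` of compact operators. -/
abbrev compact (E : FModule A) : GRing.{w, u} G :=
  GRing.sub E.endRing E.compactSubring (by
    intro g T hT
    change T ∈ AddSubgroup.closure E.elementary at hT
    change E.endRing.act g T ∈ AddSubgroup.closure E.elementary
    induction hT using AddSubgroup.closure_induction with
    | mem T hT =>
      obtain ⟨η, φ, hφ, rfl⟩ := hT
      refine AddSubgroup.subset_closure ⟨E.act g η, _, E.act_mem g φ hφ,
        AddMonoidHom.ext fun x => ?_⟩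
      exact E.act_smul g η (φ (E.act g⁻¹ x))
    | zero => rw [map_zero]; exact zero_mem _
    | add x y _ _ hx hy => rw [map_add]; exact add_mem hx hy
    | neg x _ hx => rw [map_neg]; exact neg_mem hx)

/-- The adjointable operators of `E`: the `A`-linear `V` with `φ ∘ V ∈ Θ_A(E)` for all
`φ ∈ Θ_A(E)`. -/
def adjointableSubring (E : FModule A) : NonUnitalSubring (AddMonoid.End E.carrier) where
  carrier := {V | (∀ ξ a, V (E.smul ξ a) = E.smul (V ξ) a) ∧ ∀ φ ∈ E.Θ, φ.comp V ∈ E.Θ}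
  zero_mem' := by
    refine ⟨fun ξ a => ?_, fun φ _ => ?_⟩
    · show 0 = E.smul 0 a
      rw [map_zero]
      rfl
    · have h : φ.comp (0 : AddMonoid.End E.carrier) = 0 := AddMonoidHom.ext fun x => map_zero φ
      rw [h]
      exact zero_mem _
  add_mem' := by
    rintro V W ⟨hV, hV'⟩ ⟨hW, hW'⟩
    refine ⟨fun ξ a => ?_, fun φ hφ => ?_⟩
    · show V (E.smul ξ a) + W (E.smul ξ a) = E.smul (V ξ + W ξ) a
      rw [hV, hW, map_add]
      rfl
    · have h : φ.comp (V + W) = φ.comp V + φ.comp W :=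
        AddMonoidHom.ext fun x => map_add φ (V x) (W x)
      rw [h]
      exact add_mem (hV' φ hφ) (hW' φ hφ)
  neg_mem' := by
    rintro V ⟨hV, hV'⟩
    refine ⟨fun ξ a => ?_, fun φ hφ => ?_⟩
    · show -(V (E.smul ξ a)) = E.smul (-(V ξ)) a
      rw [hV, map_neg]
      rfl
    · have h : φ.comp (-V) = -(φ.comp V) := AddMonoidHom.ext fun x => map_neg φ (V x)
      rw [h]
      exact neg_mem (hV' φ hφ)
  mul_mem' := by
    rintro V W ⟨hV, hV'⟩ ⟨hW, hW'⟩
    refine ⟨fun ξ a => ?_, fun φ hφ => hW' _ (hV' φ hφ)⟩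
    show V (W (E.smul ξ a)) = E.smul (V (W ξ)) a
    rw [hW, hV]

/-- The `G`-ring `L_A(E)` of adjointable operators. -/
abbrev adjointable (E : FModule A) : GRing.{w, u} G :=
  GRing.sub E.endRing E.adjointableSubring (by
    rintro g V ⟨hV, hV'⟩
    have h_inv : ∀ x, A.act g (A.act g⁻¹ x) = x := fun x => by
      rw [← RingAut.mul_apply, ← map_mul, mul_inv_cancel, map_one, RingAut.one_apply]
    refine ⟨fun ξ a => ?_, fun φ hφ => ?_⟩
    · show E.act g (V (E.act g⁻¹ (E.smul ξ a))) = E.smul (E.act g (V (E.act g⁻¹ ξ))) a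
      rw [E.act_smul, hV, E.act_smul, h_inv]
    · have h := E.act_mem g _ (hV' _ (E.act_mem g⁻¹ φ hφ))
      convert h using 1
      apply AddMonoidHom.ext
      intro x
      show φ (E.act g (V (E.act g⁻¹ x))) =
        A.act g (A.act g⁻¹ (φ (E.act g⁻¹⁻¹ (V (E.act g⁻¹ x)))))
      rw [h_inv, inv_inv])

end FModule

/-! ### Corner embeddings -/

/-- The data of a corner embedding of `A`: a functional module `E` and `H_A = A ⊕ ⨁_{j ∈ J} A`,
where the first summand is the distinguished coordinate and the second one carries any action,
such that `E ⊕ H_A` is cofull. -/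
structure CornerData {G : Type w} [Group G] (A : GRing.{w, u} G) : Type (max w (u + 1)) where
  E : FModule A
  J : Type u
  T : G →* AddMonoid.End (J →₀ A.carrier)
  act_smul : ∀ g x a, T g (FModule.freeSmul A J x a) = FModule.freeSmul A J (T g x) (A.act g a)
  act_functional : ∀ g c, ∃ c', ∀ x,
    A.act g (FModule.freeFunctional A J c (T g⁻¹ x)) = FModule.freeFunctional A J c' x
  cofull : (E.sum ((FModule.self A).sum (FModule.free A J T act_smul act_functional))).Cofull

namespace CornerData

variable {G : Type w} [Group G] {A : GRing.{w, u} G}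

/-- The module `E ⊕ H_A`. -/
noncomputable abbrev module (c : CornerData A) : FModule A :=
  c.E.sum ((FModule.self A).sum (FModule.free A c.J c.T c.act_smul c.act_functional))

/-- The operator `ξ ⊕ b ⊕ η ↦ 0 ⊕ a b ⊕ 0` on `E ⊕ A ⊕ ⨁_J A`. -/
noncomputable def operator (c : CornerData A) (a : A.carrier) :
    AddMonoid.End c.module.carrier :=
  AddMonoidHom.mk'
    (fun x : c.E.carrier × (A.carrier × (c.J →₀ A.carrier)) =>
      ((0, (a * x.2.1, 0)) : c.E.carrier × (A.carrier × (c.J →₀ A.carrier))))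
    (fun x y => by simp [mul_add])

theorem operator_mem (c : CornerData A) (hA : A.Quadratik) (a : A.carrier) :
    c.operator a ∈ AddSubgroup.closure c.module.elementary := by
  have h : a ∈ AddSubgroup.closure {z : A.carrier | ∃ x y : A.carrier, z = x * y} :=
    hA ▸ AddSubgroup.mem_top a
  have h_add : ∀ x y, c.operator (x + y) = c.operator x + c.operator y := fun x y =>
    AddMonoidHom.ext fun z => by
      show ((0, ((x + y) * z.2.1, 0)) : c.E.carrier × (A.carrier × (c.J →₀ A.carrier))) =
        (0, (x * z.2.1, 0)) + (0, (y * z.2.1, 0))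
      simp [add_mul]
  have h_zero : c.operator 0 = 0 := by
    have := h_add 0 0
    rw [add_zero] at this
    exact left_eq_add.mp this
  induction h using AddSubgroup.closure_induction with
  | mem z hz =>
    obtain ⟨x, y, rfl⟩ := hz
    refine AddSubgroup.subset_closure ⟨(0, (x, 0)),
      (0 : c.E.carrier →+ A.carrier).coprod ((AddMonoidHom.mul y).coprod 0),
      ⟨0, zero_mem _, _, ⟨_, ⟨y, rfl⟩, 0, zero_mem _, rfl⟩, rfl⟩, ?_⟩
    apply AddMonoidHom.ext
    intro v
    show ((0, (x * y * v.2.1, 0)) : c.E.carrier × (A.carrier × (c.J →₀ A.carrier))) =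
      (c.E.smul 0 (0 + (y * v.2.1 + 0)), (x * (0 + (y * v.2.1 + 0)),
        FModule.freeSmul A c.J 0 (0 + (y * v.2.1 + 0))))
    simp [mul_assoc]
  | zero => rw [h_zero]; exact zero_mem _
  | add x y _ _ hx hy => rw [h_add]; exact add_mem hx hy
  | neg x _ hx =>
    have h_neg : c.operator (-x) = -c.operator x :=
      eq_neg_of_add_eq_zero_left (by rw [← h_add, neg_add_cancel, h_zero])
    rw [h_neg]
    exact neg_mem hx

/-- The corner embedding `A → K_A(E ⊕ H_A)`, `a` acting by left multiplication on the
distinguished coordinate. -/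
noncomputable def embedding (c : CornerData A) (hA : A.Quadratik) : GHom A c.module.compact where
  toHom :=
    { toFun := fun a => ⟨c.operator a, c.operator_mem hA a⟩
      map_mul' := fun a b => Subtype.ext <| AddMonoidHom.ext fun x => by
        show ((0, (a * b * x.2.1, 0)) : c.E.carrier × (A.carrier × (c.J →₀ A.carrier))) =
          (0, (a * (b * x.2.1), 0))
        rw [mul_assoc]
      map_zero' := Subtype.ext <| AddMonoidHom.ext fun x => by
        show ((0, (0 * x.2.1, 0)) : c.E.carrier × (A.carrier × (c.J →₀ A.carrier))) = 0
        rw [zero_mul]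
        rfl
      map_add' := fun a b => Subtype.ext <| AddMonoidHom.ext fun x => by
        show ((0, ((a + b) * x.2.1, 0)) : c.E.carrier × (A.carrier × (c.J →₀ A.carrier))) =
          (0, (a * x.2.1, 0)) + (0, (b * x.2.1, 0))
        simp [add_mul] }
  map_act g a := Subtype.ext <| AddMonoidHom.ext fun x => by
    show ((0, (A.act g a * x.2.1, 0)) : c.E.carrier × (A.carrier × (c.J →₀ A.carrier))) =
      (c.E.act g 0, (A.act g (a * A.act g⁻¹ x.2.1), c.T g 0))
    have h : A.act g (A.act g⁻¹ x.2.1) = x.2.1 := by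
      rw [← RingAut.mul_apply, ← map_mul, mul_inv_cancel, map_one]
      rfl
    rw [map_mul, h, map_zero, map_zero]

end CornerData

/-! ### The category `GK^G` -/

/-- The object class of a category `ring^G` of quadratik `G`-rings and all equivariant ring
homomorphisms between them: a class of quadratik `G`-rings closed under direct sums, `A[0,1]`,
compact operators, adjointable operators and `M □ A`. -/
structure RingClass (G : Type w) [Group G] : Type (max w (u + 1)) where
  mem : GRing.{w, u} G → Prop
  quadratik : ∀ A, mem A → A.Quadratik
  prod_mem : ∀ A B, mem A → mem B → mem (A.prod B)
  cyl_mem : ∀ A, mem A → mem A.cyl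
  compact_mem : ∀ A, mem A → ∀ E : FModule A, E.Cofull → mem E.compact
  adjointable_mem : ∀ A, mem A → ∀ E : FModule A, E.Cofull → mem E.adjointable
  square_mem : ∀ (B M A : GRing.{w, u} G) (i : GHom B M) (s : GHom A M)
    (h_left : ∀ m b, ∃ b', m * i.toHom b = i.toHom b')
    (h_right : ∀ b m, ∃ b', i.toHom b * m = i.toHom b'),
    Function.Injective i.toHom → mem B → mem M → mem A → mem (GRing.square i s h_left h_right)

/-- The objects of `GK^G` are the rings of the given class. -/
structure GK {G : Type w} [Group G] (𝓡 : RingClass.{w, u} G) : Type (max w (u + 1)) where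
  ring : GRing.{w, u} G
  mem : 𝓡.mem ring

namespace GK

variable {G : Type w} [Group G] {𝓡 : RingClass.{w, u} G}

/-- The direct sum as an object. -/
def prod (A B : GK 𝓡) : GK 𝓡 := ⟨A.ring.prod B.ring, 𝓡.prod_mem _ _ A.mem B.mem⟩

/-- The target `K_A(E ⊕ H_A)` of a corner embedding as an object. -/
noncomputable def corner {A : GK 𝓡} (c : CornerData A.ring) : GK 𝓡 :=
  ⟨c.module.compact, 𝓡.compact_mem _ A.mem _ c.cofull⟩

/-- Formal expressions in ring homomorphisms, the synthetical inverses `e⁻¹` of corner embeddings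
and the synthetical splits `Δ_S` of split exact sequences. Compositions are written from left to
right. -/
inductive Expr : GK 𝓡 → GK 𝓡 → Type (max w (u + 1))
  | hom {A B : GK 𝓡} (f : GHom A.ring B.ring) : Expr A B
  | cornerInv {A : GK 𝓡} (c : CornerData A.ring) : Expr (corner c) A
  | delta {B M A : GK 𝓡} (S : SplitExact B.ring M.ring A.ring) : Expr M B
  | comp {A B C : GK 𝓡} (x : Expr A B) (y : Expr B C) : Expr A C
  | zero {A B : GK 𝓡} : Expr A B
  | add {A B : GK 𝓡} (x y : Expr A B) : Expr A B
  | neg {A B : GK 𝓡} (x : Expr A B) : Expr A B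

/-- The congruence on expressions generated by the laws of a category with bilinear composition
and abelian groups of morphisms, and by the defining relations of `GK^G`. -/
inductive Rel : ∀ {A B : GK 𝓡}, Expr A B → Expr A B → Prop
  -- congruence
  | refl {A B : GK 𝓡} (x : Expr A B) : Rel x x
  | symm {A B : GK 𝓡} {x y : Expr A B} : Rel x y → Rel y x
  | trans {A B : GK 𝓡} {x y z : Expr A B} : Rel x y → Rel y z → Rel x z
  | comp_congr {A B C : GK 𝓡} {x x' : Expr A B} {y y' : Expr B C} :
      Rel x x' → Rel y y' → Rel (x.comp y) (x'.comp y')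
  | add_congr {A B : GK 𝓡} {x x' y y' : Expr A B} :
      Rel x x' → Rel y y' → Rel (x.add y) (x'.add y')
  | neg_congr {A B : GK 𝓡} {x x' : Expr A B} : Rel x x' → Rel x.neg x'.neg
  -- category and unit
  | comp_assoc {A B C D : GK 𝓡} (x : Expr A B) (y : Expr B C) (z : Expr C D) :
      Rel ((x.comp y).comp z) (x.comp (y.comp z))
  | id_comp {A B : GK 𝓡} (x : Expr A B) : Rel ((Expr.hom (GHom.id A.ring)).comp x) x
  | comp_id {A B : GK 𝓡} (x : Expr A B) : Rel (x.comp (Expr.hom (GHom.id B.ring))) x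
  -- addition and subtraction
  | add_assoc {A B : GK 𝓡} (x y z : Expr A B) : Rel ((x.add y).add z) (x.add (y.add z))
  | add_comm {A B : GK 𝓡} (x y : Expr A B) : Rel (x.add y) (y.add x)
  | zero_add {A B : GK 𝓡} (x : Expr A B) : Rel (Expr.zero.add x) x
  | neg_add_cancel {A B : GK 𝓡} (x : Expr A B) : Rel (x.neg.add x) Expr.zero
  | comp_add {A B C : GK 𝓡} (x : Expr A B) (y z : Expr B C) :
      Rel (x.comp (y.add z)) ((x.comp y).add (x.comp z))
  | add_comp {A B C : GK 𝓡} (x y : Expr A B) (z : Expr B C) :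
      Rel ((x.add y).comp z) ((x.comp z).add (y.comp z))
  -- composition of ring homomorphisms
  | hom_comp {A B C : GK 𝓡} (f : GHom A.ring B.ring) (g : GHom B.ring C.ring) :
      Rel ((Expr.hom f).comp (Expr.hom g)) (Expr.hom (A := A) (B := C) (f.comp g))
  -- additive category
  | additive (A B : GK 𝓡) :
      Rel (Expr.hom (GHom.id (prod A B).ring))
        (((Expr.hom (A := prod A B) (B := A) (GRing.fst A.ring B.ring)).comp
            (Expr.hom (B := prod A B) (GRing.inl A.ring B.ring))).add
          ((Expr.hom (A := prod A B) (B := B) (GRing.snd A.ring B.ring)).comp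
            (Expr.hom (B := prod A B) (GRing.inr A.ring B.ring))))
  -- homotopy invariance
  | homotopy {A B : GK 𝓡} (f₀ f₁ : GHom A.ring B.ring) :
      Homotopic f₀ f₁ → Rel (Expr.hom f₀) (Expr.hom f₁)
  -- stability
  | corner_comp_inv {A : GK 𝓡} (c : CornerData A.ring) :
      Rel ((Expr.hom (B := corner c) (c.embedding (𝓡.quadratik _ A.mem))).comp
        (Expr.cornerInv c)) (Expr.hom (GHom.id A.ring))
  | inv_comp_corner {A : GK 𝓡} (c : CornerData A.ring) :
      Rel ((Expr.cornerInv c).comp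
        (Expr.hom (B := corner c) (c.embedding (𝓡.quadratik _ A.mem))))
        (Expr.hom (GHom.id (corner c).ring))
  -- split exactness
  | j_delta {B M A : GK 𝓡} (S : SplitExact B.ring M.ring A.ring) :
      Rel ((Expr.hom S.j).comp (Expr.delta S)) (Expr.hom (GHom.id B.ring))
  | delta_j {B M A : GK 𝓡} (S : SplitExact B.ring M.ring A.ring) :
      Rel (Expr.hom (GHom.id M.ring))
        (((Expr.delta S).comp (Expr.hom S.j)).add
          ((Expr.hom (B := A) S.f).comp (Expr.hom S.s)))

/-- The category `GK^G`. -/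
instance : Category (GK 𝓡) where
  Hom A B := Quot (Rel (A := A) (B := B))
  id A := Quot.mk _ (Expr.hom (GHom.id A.ring))
  comp := Quot.map₂ Expr.comp (fun x _ _ h => Rel.comp_congr (Rel.refl x) h)
    (fun _ _ y h => Rel.comp_congr h (Rel.refl y))
  id_comp := by
    rintro A B ⟨x⟩
    exact Quot.sound (Rel.id_comp x)
  comp_id := by
    rintro A B ⟨x⟩
    exact Quot.sound (Rel.comp_id x)
  assoc := by
    rintro A B C D ⟨x⟩ ⟨y⟩ ⟨z⟩
    exact Quot.sound (Rel.comp_assoc x y z)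

/-- The morphism of `GK^G` represented by an expression. -/
def ofExpr {A B : GK 𝓡} (x : Expr A B) : A ⟶ B := Quot.mk _ x

instance (A B : GK 𝓡) : Add (A ⟶ B) where
  add := Quot.map₂ Expr.add (fun x _ _ h => Rel.add_congr (Rel.refl x) h)
    (fun _ _ y h => Rel.add_congr h (Rel.refl y))

instance (A B : GK 𝓡) : Zero (A ⟶ B) where
  zero := ofExpr Expr.zero

instance (A B : GK 𝓡) : Neg (A ⟶ B) where
  neg := Quot.map Expr.neg (fun _ _ h => Rel.neg_congr h)

instance (A B : GK 𝓡) : AddCommGroup (A ⟶ B) where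
  add_assoc := by
    rintro ⟨x⟩ ⟨y⟩ ⟨z⟩
    exact Quot.sound (Rel.add_assoc x y z)
  zero_add := by
    rintro ⟨x⟩
    exact Quot.sound (Rel.zero_add x)
  add_zero := by
    rintro ⟨x⟩
    exact Quot.sound (Rel.trans (Rel.add_comm _ _) (Rel.zero_add x))
  neg_add_cancel := by
    rintro ⟨x⟩
    exact Quot.sound (Rel.neg_add_cancel x)
  add_comm := by
    rintro ⟨x⟩ ⟨y⟩
    exact Quot.sound (Rel.add_comm x y)
  nsmul := nsmulRec
  zsmul := zsmulRec

instance : Preadditive (GK 𝓡) where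
  add_comp := by
    rintro A B C ⟨x⟩ ⟨y⟩ ⟨z⟩
    exact Quot.sound (Rel.add_comp x y z)
  comp_add := by
    rintro A B C ⟨x⟩ ⟨y⟩ ⟨z⟩
    exact Quot.sound (Rel.comp_add x y z)

/-- The morphism of `GK^G` given by a ring homomorphism. -/
def ofHom {A B : GK 𝓡} (f : GHom A.ring B.ring) : A ⟶ B := ofExpr (Expr.hom f)

/-- The morphisms of `L_0 GK^G`, the smallest additive subcategory of `GK^G` which contains all
ring homomorphisms. -/
inductive IsLevelZero : ∀ {A B : GK 𝓡}, (A ⟶ B) → Prop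
  | ofHom {A B : GK 𝓡} (f : GHom A.ring B.ring) : IsLevelZero (ofHom f)
  | comp {A B C : GK 𝓡} {x : A ⟶ B} {y : B ⟶ C} :
      IsLevelZero x → IsLevelZero y → IsLevelZero (x ≫ y)
  | zero {A B : GK 𝓡} : IsLevelZero (0 : A ⟶ B)
  | add {A B : GK 𝓡} {x y : A ⟶ B} : IsLevelZero x → IsLevelZero y → IsLevelZero (x + y)
  | neg {A B : GK 𝓡} {x : A ⟶ B} : IsLevelZero x → IsLevelZero (-x)

variable (𝓡) in
/-- The level-0 morphisms as a property of morphisms. -/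
def levelZero : MorphismProperty (GK 𝓡) := fun _ _ x => IsLevelZero x

instance : (levelZero 𝓡).IsMultiplicative where
  id_mem A := IsLevelZero.ofHom (GHom.id A.ring)
  comp_mem _ _ hx hy := IsLevelZero.comp hx hy

variable (𝓡) in
/-- The subcategory `L_0 GK^G` (with all objects of `GK^G`). -/
abbrev L0 : Type (max w (u + 1)) := WideSubcategory (levelZero 𝓡)

variable (𝓡) in
/-- The inclusion of `L_0 GK^G` into `GK^G`. -/
def inclusionL0 : L0 𝓡 ⥤ GK 𝓡 := wideSubcategoryInclusion (levelZero 𝓡)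

end GK

end GKTheory

namespace GKTheory

variable {G : Type w} [Group G]

/-! The theorem is a clearing of denominators. Let Q be the class of compositions of corner
embeddings e and ideal embeddings j of split exact sequences. Its members are ring homomorphisms,
and they are monomorphisms in GK because e e⁻¹ = 1 and j Δ = 1. The claim is that every morphism x
has some q in Q with x q of level 0 (`exists_isLevelZero_comp`). For two parallel morphisms a common
q can be chosen. If F(x) = F(y), then F(xq) = F(yq), so xq = yq by faithfulness on level 0, and x =
y because q is mono. Sums occur only inside GK, so F need not be additive.

The generators cause no trouble: e⁻¹ e = 1 and Δ j = 1 - f s are of level 0. For compositions and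
sums a denominator must move past a homomorphism: given h : A → B and q : A → A' in Q, there must be
q' : B → B' in Q and h' : A' → B' with h q' = q h' (`exists_hom_square`).

For a corner embedding A → K(N), induce N along h to N ⊗ B and take h' : K(N) → K((N ⊗ B) ⊕ B). Then
q h' and h followed by the corner embedding of B are the diagonal entries of a system of 2×2 matrix
units, hence homotopic by a rotation (`exists_corner_square`). For an ideal embedding B → M and h :
B → C, the same construction with N = B gives B → K := K((B ⊗ C) ⊕ C). It extends to M because M
acts on its ideal B by multipliers, but with values in the adjointable operators L. The ring L □ A
turns K ⊆ L into the ideal of a split exact sequence that receives M (`exists_ideal_square`). -/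

theorem GRing.act_act_inv (A : GRing.{w, u} G) (g : G) (a : A.carrier) :
    A.act g (A.act g⁻¹ a) = a := by
  rw [← RingAut.mul_apply, ← map_mul, mul_inv_cancel, map_one, RingAut.one_apply]

theorem map_mem_of_mem_closure {X Y : Type*} [AddGroup X] [AddGroup Y] (Φ : X →+ Y) {s : Set X}
    {S : AddSubgroup Y} {x : X} (hx : x ∈ AddSubgroup.closure s) (hs : ∀ y ∈ s, Φ y ∈ S) :
    Φ x ∈ S :=
  (AddSubgroup.closure_le (S.comap Φ)).2 hs hx

/-! ### Spanning sets of cofull modules -/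

namespace FModule

variable {A B : GRing.{w, u} G}

/-- The elements `ξ a` span a cofull module. -/
theorem Cofull.closure_smul {N : FModule A} (hN : N.Cofull) :
    AddSubgroup.closure {ζ : N.carrier | ∃ ξ a, ζ = N.smul ξ a} = ⊤ := by
  rw [eq_top_iff, ← hN]
  exact AddSubgroup.closure_mono fun ζ ⟨ξ, η, φ, _, h⟩ => ⟨ξ, φ η, h⟩

/-- An additive map on a cofull module takes values in a subgroup if it does so on the elements
`ξ a₁ a₂ φ(η)`. -/
theorem Cofull.map_mem_of_smul {N : FModule A} (hN : N.Cofull) {Y : Type*} [AddGroup Y]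
    (Φ : N.carrier →+ Y) {S : AddSubgroup Y}
    (hS : ∀ ξ a b η, ∀ φ ∈ N.Θ, Φ (N.smul (N.smul (N.smul ξ a) b) (φ η)) ∈ S) (x : N.carrier) :
    Φ x ∈ S := by
  have hx : x ∈ AddSubgroup.closure {ζ : N.carrier | ∃ ξ η, ∃ φ ∈ N.Θ, ζ = N.smul ξ (φ η)} :=
    hN ▸ AddSubgroup.mem_top x
  refine map_mem_of_mem_closure Φ hx ?_
  rintro _ ⟨ξ, η, φ, hφ, rfl⟩
  have h₁ : ∀ ξ : N.carrier, ξ ∈ AddSubgroup.closure {ζ : N.carrier | ∃ ξ a, ζ = N.smul ξ a} :=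
    fun ξ => hN.closure_smul ▸ AddSubgroup.mem_top ξ
  -- Splitting off a ring factor twice supplies the spare factors a, b that replace a unit in the
  -- arguments below.
  refine map_mem_of_mem_closure (Φ.comp (N.smul.flip (φ η))) (h₁ ξ) ?_
  rintro _ ⟨ζ, b, rfl⟩
  refine map_mem_of_mem_closure (Φ.comp ((N.smul.flip (φ η)).comp (N.smul.flip b))) (h₁ ζ) ?_
  rintro _ ⟨ξ, a, rfl⟩
  exact hS ξ a b η φ hφ

/-! ### Compact operators as an ideal -/

theorem compact_mem_adjointable (N : FModule A) {T : AddMonoid.End N.carrier}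
    (hT : T ∈ N.compactSubring) : T ∈ N.adjointableSubring := by
  refine (AddSubgroup.closure_le N.adjointableSubring.toAddSubgroup).2 ?_ hT
  rintro _ ⟨η, φ, hφ, rfl⟩
  refine ⟨fun ξ a => ?_, fun ψ hψ => ?_⟩
  · show N.smul η (φ (N.smul ξ a)) = N.smul (N.smul η (φ ξ)) a
    rw [N.map_smul φ hφ, N.smul_mul]
  · convert N.left_mem (ψ η) φ hφ using 1
    exact AddMonoidHom.ext fun x => N.map_smul ψ hψ _ _

/-- On elementary operators V θ_{η,φ} = θ_{Vη,φ}; on the other side θ_{η,φ} V = θ_{η,φ∘V}, which is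
compact because V is adjointable. -/
theorem adjointable_mul_compact (N : FModule A) {V T : AddMonoid.End N.carrier}
    (hV : V ∈ N.adjointableSubring) (hT : T ∈ N.compactSubring) : V * T ∈ N.compactSubring := by
  refine (AddSubgroup.closure_le
    (N.compactSubring.toAddSubgroup.comap (AddMonoidHom.mulLeft V))).2 ?_ hT
  rintro _ ⟨η, φ, hφ, rfl⟩
  exact AddSubgroup.subset_closure ⟨V η, φ, hφ, AddMonoidHom.ext fun x => hV.1 _ _⟩

theorem compact_mul_adjointable (N : FModule A) {V T : AddMonoid.End N.carrier}
    (hT : T ∈ N.compactSubring) (hV : V ∈ N.adjointableSubring) : T * V ∈ N.compactSubring := by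
  refine (AddSubgroup.closure_le
    (N.compactSubring.toAddSubgroup.comap (AddMonoidHom.mulRight V))).2 ?_ hT
  rintro _ ⟨η, φ, hφ, rfl⟩
  exact AddSubgroup.subset_closure ⟨η, φ.comp V, hV.2 φ hφ, rfl⟩

/-- The inclusion `K_A(N) → L_A(N)`. -/
def compactIncl (N : FModule A) : GHom N.compact N.adjointable where
  toHom :=
    { toFun := fun T => ⟨T.1, N.compact_mem_adjointable T.2⟩
      map_mul' := fun _ _ => rfl
      map_zero' := rfl
      map_add' := fun _ _ => rfl }
  map_act _ _ := rfl

theorem compactIncl_injective (N : FModule A) : Function.Injective N.compactIncl.toHom :=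
  fun _ _ h => Subtype.ext (congrArg (fun V : N.adjointable.carrier => V.1) h)

theorem compactIncl_left (N : FModule A) (V : N.adjointable.carrier) (T : N.compact.carrier) :
    ∃ T', V * N.compactIncl.toHom T = N.compactIncl.toHom T' :=
  ⟨⟨V.1 * T.1, N.adjointable_mul_compact V.2 T.2⟩, rfl⟩

theorem compactIncl_right (N : FModule A) (T : N.compact.carrier) (V : N.adjointable.carrier) :
    ∃ T', N.compactIncl.toHom T * V = N.compactIncl.toHom T' :=
  ⟨⟨T.1 * V.1, N.compact_mul_adjointable T.2 V.2⟩, rfl⟩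

/-- The restriction to compact operators of a homomorphism of adjointable operators which
preserves them. -/
def compactRestrict {N : FModule A} {E : FModule B} (f : GHom N.adjointable E.adjointable)
    (hf : ∀ V, V.1 ∈ N.compactSubring → (f.toHom V).1 ∈ E.compactSubring) :
    GHom N.compact E.compact where
  toHom :=
    { toFun := fun T => ⟨(f.toHom (N.compactIncl.toHom T)).1, hf _ T.2⟩
      map_mul' := fun S T => Subtype.ext (congrArg (fun V : E.adjointable.carrier => V.1)
        (map_mul (N.compactIncl.comp f).toHom S T))
      map_zero' := Subtype.ext (congrArg (fun V : E.adjointable.carrier => V.1)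
        (map_zero (N.compactIncl.comp f).toHom))
      map_add' := fun S T => Subtype.ext (congrArg (fun V : E.adjointable.carrier => V.1)
        (map_add (N.compactIncl.comp f).toHom S T)) }
  map_act g T := Subtype.ext (by
    show (f.toHom (N.compactIncl.toHom (N.compact.act g T))).1 = _
    rw [N.compactIncl.map_act, f.map_act]
    rfl)

/-- The operator `V ⊕ 0` on `E ⊕ F`. -/
def extendZero (E F : FModule A) : GHom E.adjointable (E.sum F).adjointable where
  toHom :=
    { toFun := fun V => ⟨(AddMonoidHom.prodMap (V.1 : E.carrier →+ E.carrier)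
          (0 : F.carrier →+ F.carrier) : E.carrier × F.carrier →+ E.carrier × F.carrier),
        fun ξ a => Prod.ext (V.2.1 ξ.1 a) (by
          show (0 : F.carrier) = F.smul 0 a
          rw [map_zero]; rfl), by
        rintro _ ⟨φ, hφ, ψ, hψ, rfl⟩
        refine ⟨_, V.2.2 φ hφ, 0, F.Θ.zero_mem, AddMonoidHom.ext fun x => ?_⟩
        show φ (V.1 x.1) + ψ 0 = φ (V.1 x.1) + 0
        rw [map_zero]⟩
      map_mul' := fun V W => Subtype.ext (AddMonoidHom.ext fun x => rfl)
      map_zero' := Subtype.ext (AddMonoidHom.ext fun x => rfl)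
      map_add' := fun V W => Subtype.ext (AddMonoidHom.ext fun x =>
        Prod.ext rfl (add_zero (0 : F.carrier)).symm) }
  map_act g V := Subtype.ext (AddMonoidHom.ext fun x => Prod.ext rfl (map_zero (F.act g)).symm)

theorem extendZero_compact (E F : FModule A) (V : E.adjointable.carrier)
    (hV : V.1 ∈ E.compactSubring) : ((E.extendZero F).toHom V).1 ∈ (E.sum F).compactSubring := by
  let Φ : AddMonoid.End E.carrier →+ AddMonoid.End (E.sum F).carrier := AddMonoidHom.mk'
    (fun V => (AddMonoidHom.prodMap (V : E.carrier →+ E.carrier)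
      (0 : F.carrier →+ F.carrier) : E.carrier × F.carrier →+ E.carrier × F.carrier))
    (fun V W => AddMonoidHom.ext fun x => Prod.ext rfl (add_zero (0 : F.carrier)).symm)
  refine (AddSubgroup.closure_le ((E.sum F).compactSubring.toAddSubgroup.comap Φ)).2 ?_ hV
  rintro _ ⟨η, φ, hφ, rfl⟩
  refine AddSubgroup.subset_closure ⟨((η, 0) : E.carrier × F.carrier), φ.coprod 0,
    ⟨φ, hφ, 0, F.Θ.zero_mem, rfl⟩, AddMonoidHom.ext fun x => ?_⟩
  show ((E.smul η (φ x.1), 0) : E.carrier × F.carrier) =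
    (E.smul η (φ x.1 + 0), F.smul 0 (φ x.1 + 0))
  rw [add_zero, map_zero]
  rfl

/-! ### Cofullness of direct sums and of the ring itself -/

theorem Cofull.sum {E F : FModule A} (hE : E.Cofull) (hF : F.Cofull) : (E.sum F).Cofull := by
  have h₁ : ∀ x : E.carrier, ((x, 0) : E.carrier × F.carrier) ∈ AddSubgroup.closure
      {ζ | ∃ ξ η, ∃ φ ∈ (E.sum F).Θ, ζ = (E.sum F).smul ξ (φ η)} := by
    intro x
    have hx := hE ▸ AddSubgroup.mem_top x
    refine map_mem_of_mem_closure (AddMonoidHom.inl E.carrier F.carrier) hx ?_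
    rintro _ ⟨ξ, η, φ, hφ, rfl⟩
    refine AddSubgroup.subset_closure ⟨((ξ, 0) : E.carrier × F.carrier), (η, 0), φ.coprod 0,
      ⟨φ, hφ, 0, F.Θ.zero_mem, rfl⟩, ?_⟩
    show ((E.smul ξ (φ η), 0) : E.carrier × F.carrier) =
      (E.smul ξ (φ η + 0), F.smul 0 (φ η + 0))
    rw [add_zero, map_zero]
    rfl
  have h₂ : ∀ x : F.carrier, ((0, x) : E.carrier × F.carrier) ∈ AddSubgroup.closure
      {ζ | ∃ ξ η, ∃ φ ∈ (E.sum F).Θ, ζ = (E.sum F).smul ξ (φ η)} := by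
    intro x
    have hx := hF ▸ AddSubgroup.mem_top x
    refine map_mem_of_mem_closure (AddMonoidHom.inr E.carrier F.carrier) hx ?_
    rintro _ ⟨ξ, η, φ, hφ, rfl⟩
    refine AddSubgroup.subset_closure ⟨((0, ξ) : E.carrier × F.carrier), (0, η),
      (0 : E.carrier →+ A.carrier).coprod φ, ⟨0, E.Θ.zero_mem, φ, hφ, rfl⟩, ?_⟩
    show ((0, F.smul ξ (φ η)) : E.carrier × F.carrier) =
      (E.smul 0 (0 + φ η), F.smul ξ (0 + φ η))
    rw [zero_add, map_zero]
    rfl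
  refine eq_top_iff.2 fun x _ => ?_
  have hx := add_mem (h₁ x.1) (h₂ x.2)
  have e : ((x.1, 0) : E.carrier × F.carrier) + (0, x.2) = x := by simp
  rw [e] at hx
  exact hx

/-- The spanning elements ξ φ(η) of A are the triple products, so being quadratik is used twice. -/
theorem cofull_self (hA : A.Quadratik) : (self A).Cofull := by
  have h₀ : ∀ x : A.carrier, x ∈ AddSubgroup.closure {c | ∃ a b : A.carrier, c = a * b} :=
    fun x => hA ▸ AddSubgroup.mem_top x
  refine eq_top_iff.2 fun x _ => ?_
  refine (AddSubgroup.closure_le _).2 ?_ (h₀ x)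
  rintro _ ⟨a, b, rfl⟩
  refine map_mem_of_mem_closure (AddMonoidHom.mulLeft a) (h₀ b) ?_
  rintro _ ⟨b, c, rfl⟩
  exact AddSubgroup.subset_closure ⟨a, c, AddMonoidHom.mul b, ⟨b, rfl⟩, rfl⟩

/-! ### The induced module `N ⊗_h B` -/

section Induced

variable (N : FModule A) (h : GHom A B)

/-- The image of `x ⊗ b` in the additive maps `Θ_A(N) → B`. -/
def inducedTmul (x : N.carrier) (b : B.carrier) : N.Θ →+ B.carrier :=
  AddMonoidHom.mk' (fun φ => h.toHom (φ.1 x) * b) (fun φ ψ => by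
    show h.toHom (φ.1 x + ψ.1 x) * b = _
    rw [map_add, add_mul])

/-- The additive group generated by the `x ⊗ b`. -/
def inducedGroup : AddSubgroup (N.Θ →+ B.carrier) :=
  AddSubgroup.closure {f | ∃ x b, f = N.inducedTmul h x b}

theorem inducedTmul_mem (x : N.carrier) (b : B.carrier) :
    N.inducedTmul h x b ∈ N.inducedGroup h :=
  AddSubgroup.subset_closure ⟨x, b, rfl⟩

variable {N h} in
theorem mem_of_inducedGroup {f : N.Θ →+ B.carrier} (hf : f ∈ N.inducedGroup h)
    {H : Type*} [AddCommGroup H] (Φ : (N.Θ →+ B.carrier) →+ H) (S : AddSubgroup H)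
    (hS : ∀ x b, Φ (N.inducedTmul h x b) ∈ S) : Φ f ∈ S := by
  refine (AddSubgroup.closure_le (S.comap Φ)).2 ?_ hf
  rintro _ ⟨x, b, rfl⟩
  exact hS x b

/-- The action of `g` on functionals. -/
def actFunctional (g : G) : N.Θ →+ N.Θ :=
  AddMonoidHom.mk' (fun φ => ⟨_, N.act_mem g φ.1 φ.2⟩) (fun φ ψ => Subtype.ext
    (AddMonoidHom.ext fun x => map_add (A.act g) (φ.1 (N.act g⁻¹ x)) (ψ.1 (N.act g⁻¹ x))))

theorem actFunctional_one (φ : N.Θ) : N.actFunctional 1 φ = φ :=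
  Subtype.ext (AddMonoidHom.ext fun x => by
    show A.act 1 (φ.1 (N.act 1⁻¹ x)) = φ.1 x
    rw [inv_one, map_one, map_one]
    rfl)

theorem actFunctional_mul (g g' : G) (φ : N.Θ) :
    N.actFunctional (g * g') φ = N.actFunctional g (N.actFunctional g' φ) :=
  Subtype.ext (AddMonoidHom.ext fun x => by
    show A.act (g * g') (φ.1 (N.act (g * g')⁻¹ x)) =
      A.act g (A.act g' (φ.1 (N.act g'⁻¹ (N.act g⁻¹ x))))
    rw [mul_inv_rev, map_mul, map_mul]
    rfl)

/-- Right multiplication of the additive maps `Θ_A(N) → B` by `b`. -/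
def inducedMulRight (b : B.carrier) : (N.Θ →+ B.carrier) →+ (N.Θ →+ B.carrier) :=
  AddMonoidHom.compHom (AddMonoidHom.mulRight b)

/-- The action of `g` on the additive maps `Θ_A(N) → B`. -/
def inducedActAux (g : G) : (N.Θ →+ B.carrier) →+ (N.Θ →+ B.carrier) :=
  AddMonoidHom.mk' (fun f => (B.act g : B.carrier →+ B.carrier).comp
    (f.comp (N.actFunctional g⁻¹))) (fun f f' => AddMonoidHom.ext fun φ =>
      map_add (B.act g) (f (N.actFunctional g⁻¹ φ)) (f' (N.actFunctional g⁻¹ φ)))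

theorem inducedActAux_tmul (g : G) (x : N.carrier) (b : B.carrier) :
    N.inducedActAux g (N.inducedTmul h x b) = N.inducedTmul h (N.act g x) (B.act g b) :=
  AddMonoidHom.ext fun φ => by
    show B.act g (h.toHom (A.act g⁻¹ (φ.1 (N.act g⁻¹⁻¹ x))) * b) =
      h.toHom (φ.1 (N.act g x)) * B.act g b
    rw [map_mul, ← h.map_act, A.act_act_inv, inv_inv]

theorem inducedMulRight_mem (b : B.carrier) {f : N.Θ →+ B.carrier} (hf : f ∈ N.inducedGroup h) :
    N.inducedMulRight b f ∈ N.inducedGroup h :=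
  mem_of_inducedGroup hf _ _ fun x c => by
    convert N.inducedTmul_mem h x (c * b) using 1
    exact AddMonoidHom.ext fun φ => mul_assoc _ _ _

theorem inducedActAux_mem (g : G) {f : N.Θ →+ B.carrier} (hf : f ∈ N.inducedGroup h) :
    N.inducedActAux g f ∈ N.inducedGroup h :=
  mem_of_inducedGroup hf _ _ fun x c => by
    rw [inducedActAux_tmul]
    exact N.inducedTmul_mem h _ _

/-- The functional `f ↦ b f(φ)`. -/
def inducedFunctional (b : B.carrier) (φ : N.Θ) : N.inducedGroup h →+ B.carrier :=
  AddMonoidHom.mk' (fun f => b * f.1 φ) (fun f f' => mul_add b (f.1 φ) (f'.1 φ))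

/-- The right multiplication on `N ⊗_h B`. -/
def inducedSmul : N.inducedGroup h →+ B.carrier →+ N.inducedGroup h :=
  AddMonoidHom.mk'
    (fun f => AddMonoidHom.mk' (fun b => ⟨N.inducedMulRight b f.1, N.inducedMulRight_mem h b f.2⟩)
      (fun b b' => Subtype.ext (AddMonoidHom.ext fun φ => mul_add (f.1 φ) b b')))
    (fun f f' => AddMonoidHom.ext fun b => Subtype.ext (AddMonoidHom.ext fun φ =>
      add_mul (f.1 φ) (f'.1 φ) b))

/-- The diagonal action on `N ⊗_h B`. -/
def inducedAct : G →* AddMonoid.End (N.inducedGroup h) where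
  toFun g := AddMonoidHom.mk'
    (fun f => ⟨N.inducedActAux g f.1, N.inducedActAux_mem h g f.2⟩)
    (fun f f' => Subtype.ext (map_add (N.inducedActAux g) f.1 f'.1))
  map_one' := AddMonoidHom.ext fun f => Subtype.ext (AddMonoidHom.ext fun φ => by
    show B.act 1 (f.1 (N.actFunctional 1⁻¹ φ)) = f.1 φ
    rw [inv_one, actFunctional_one, map_one]
    rfl)
  map_mul' g g' := AddMonoidHom.ext fun f => Subtype.ext (AddMonoidHom.ext fun φ => by
    show B.act (g * g') (f.1 (N.actFunctional (g * g')⁻¹ φ)) =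
      B.act g (B.act g' (f.1 (N.actFunctional g'⁻¹ (N.actFunctional g⁻¹ φ))))
    rw [mul_inv_rev, actFunctional_mul, map_mul]
    rfl)

/-- The functionals on `N ⊗_h B`, spanned by the `f ↦ b f(φ)`. -/
def inducedΘ : AddSubgroup (N.inducedGroup h →+ B.carrier) :=
  AddSubgroup.closure {χ | ∃ b φ, χ = N.inducedFunctional h b φ}

theorem inducedΘ_map_smul (χ : N.inducedGroup h →+ B.carrier) (hχ : χ ∈ N.inducedΘ h)
    (f : N.inducedGroup h) (b : B.carrier) : χ (N.inducedSmul h f b) = χ f * b := by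
  unfold inducedΘ at hχ
  induction hχ using AddSubgroup.closure_induction with
  | mem χ hχ =>
    obtain ⟨c, φ, rfl⟩ := hχ
    exact (mul_assoc c (f.1 φ) b).symm
  | zero => exact (zero_mul b).symm
  | add χ ψ _ _ hχ hψ =>
    exact (congrArg₂ (· + ·) hχ hψ).trans (add_mul _ _ _).symm
  | neg χ _ hχ => exact (congrArg Neg.neg hχ).trans (neg_mul _ _).symm

theorem inducedΘ_left_mem (b : B.carrier) (χ : N.inducedGroup h →+ B.carrier)
    (hχ : χ ∈ N.inducedΘ h) : (AddMonoidHom.mulLeft b).comp χ ∈ N.inducedΘ h := by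
  refine map_mem_of_mem_closure (AddMonoidHom.compHom (AddMonoidHom.mulLeft b)) hχ ?_
  rintro _ ⟨c, φ, rfl⟩
  exact AddSubgroup.subset_closure ⟨b * c, φ, AddMonoidHom.ext fun f => (mul_assoc _ _ _).symm⟩

theorem inducedΘ_act_mem (g : G) (χ : N.inducedGroup h →+ B.carrier) (hχ : χ ∈ N.inducedΘ h) :
    (B.act g : B.carrier →+ B.carrier).comp
      (χ.comp (N.inducedAct h g⁻¹ : N.inducedGroup h →+ N.inducedGroup h)) ∈ N.inducedΘ h := by
  let S : N.inducedGroup h →+ N.inducedGroup h := N.inducedAct h g⁻¹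
  let β : B.carrier →+ B.carrier := B.act g
  refine map_mem_of_mem_closure (S := N.inducedΘ h)
    (AddMonoidHom.mk' (fun χ : N.inducedGroup h →+ B.carrier => β.comp (χ.comp S))
      (fun χ ψ => AddMonoidHom.ext fun f => map_add β (χ (S f)) (ψ (S f)))) hχ ?_
  rintro _ ⟨c, φ, rfl⟩
  refine AddSubgroup.subset_closure ⟨B.act g c, N.actFunctional g φ,
    AddMonoidHom.ext fun f => ?_⟩
  show B.act g (c * B.act g⁻¹ (f.1 (N.actFunctional g⁻¹⁻¹ φ))) = _ * _
  rw [map_mul, B.act_act_inv, inv_inv]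

/-- The induced functional module `N ⊗_h B`, separated by its functionals. -/
abbrev induced : FModule B where
  carrier := N.inducedGroup h
  smul := N.inducedSmul h
  smul_mul f b b' := Subtype.ext (AddMonoidHom.ext fun φ => (mul_assoc (f.1 φ) b b').symm)
  act := N.inducedAct h
  act_smul g f b := Subtype.ext (AddMonoidHom.ext fun φ =>
    map_mul (B.act g) (f.1 (N.actFunctional g⁻¹ φ)) b)
  Θ := N.inducedΘ h
  map_smul := N.inducedΘ_map_smul h
  left_mem := N.inducedΘ_left_mem h
  act_mem := N.inducedΘ_act_mem h

/-- The element `x ⊗ b` of `N ⊗_h B`. -/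
def tmul (x : N.carrier) (b : B.carrier) : (N.induced h).carrier :=
  ⟨N.inducedTmul h x b, N.inducedTmul_mem h x b⟩

theorem tmul_smul (x : N.carrier) (b c : B.carrier) :
    (N.induced h).smul (N.tmul h x b) c = N.tmul h x (b * c) :=
  Subtype.ext (AddMonoidHom.ext fun _ => mul_assoc _ _ _)

theorem smul_tmul (x : N.carrier) (a : A.carrier) (b : B.carrier) :
    N.tmul h (N.smul x a) b = N.tmul h x (h.toHom a * b) :=
  Subtype.ext (AddMonoidHom.ext fun φ => by
    show h.toHom (φ.1 (N.smul x a)) * b = h.toHom (φ.1 x) * (h.toHom a * b)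
    rw [N.map_smul φ.1 φ.2, map_mul, mul_assoc])

/-- `x ⊗ b` is additive in `x`. -/
def tmulLeft (b : B.carrier) : N.carrier →+ (N.induced h).carrier :=
  AddMonoidHom.mk' (fun x => N.tmul h x b) (fun x y => Subtype.ext (AddMonoidHom.ext fun φ => by
    show h.toHom (φ.1 (x + y)) * b = h.toHom (φ.1 x) * b + h.toHom (φ.1 y) * b
    rw [map_add, map_add, add_mul]))

theorem functional_mem (b : B.carrier) (φ : N.Θ) :
    N.inducedFunctional h b φ ∈ (N.induced h).Θ :=
  AddSubgroup.subset_closure ⟨b, φ, rfl⟩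

theorem induced_closure :
    AddSubgroup.closure {f : (N.induced h).carrier | ∃ x b, f = N.tmul h x b} = ⊤ := by
  refine eq_top_iff.2 fun f _ => ?_
  obtain ⟨f, hf⟩ := f
  have hf' : f ∈ AddSubgroup.closure {f | ∃ x b, f = N.inducedTmul h x b} := hf
  induction hf' using AddSubgroup.closure_induction with
  | mem f hx =>
    obtain ⟨x, b, rfl⟩ := hx
    exact AddSubgroup.subset_closure ⟨x, b, rfl⟩
  | zero => exact zero_mem _
  | add f f' h₁ h₂ i₁ i₂ => exact add_mem (i₁ h₁ trivial) (i₂ h₂ trivial)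
  | neg f h₁ i₁ => exact neg_mem (i₁ h₁ trivial)

/-- For x = ξ a a' φ(η), the element x ⊗ b equals (ξ ⊗ h(a)) · χ(η ⊗ b), where χ is evaluation at φ
multiplied on the left by h(a'). The two factors a, a' are needed because B has no unit: one fills
the tensor ξ ⊗ h(a), the other the coefficient of χ. -/
theorem Cofull.induced {N : FModule A} (hN : N.Cofull) (h : GHom A B) : (N.induced h).Cofull := by
  refine eq_top_iff.2 ?_
  rw [← N.induced_closure h, AddSubgroup.closure_le]
  rintro _ ⟨x, b, rfl⟩
  refine hN.map_mem_of_smul (N.tmulLeft h b) (fun ξ a a' η φ hφ => ?_) x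
  refine AddSubgroup.subset_closure ⟨N.tmul h ξ (h.toHom a), N.tmul h η b,
    N.inducedFunctional h (h.toHom a') ⟨φ, hφ⟩, N.functional_mem h _ _, ?_⟩
  show N.tmul h (N.smul (N.smul (N.smul ξ a) a') (φ η)) b =
    (N.induced h).smul (N.tmul h ξ (h.toHom a)) (h.toHom a' * (h.toHom (φ η) * b))
  rw [smul_tmul, smul_tmul, smul_tmul, tmul_smul]

/-- The left A-linearity φ ↦ aφ is visible on the generators x ⊗ b and passes to sums. It takes over
the role of the balancing relation of the tensor product whenever h(a) has to be absorbed into a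
functional. -/
theorem induced_map_smul (f : (N.induced h).carrier) (a : A.carrier) (φ : N.Θ) :
    f.1 ⟨_, N.left_mem a φ.1 φ.2⟩ = h.toHom a * f.1 φ := by
  obtain ⟨f, hf⟩ := f
  have hf' : f ∈ AddSubgroup.closure {f | ∃ x b, f = N.inducedTmul h x b} := hf
  show f ⟨_, N.left_mem a φ.1 φ.2⟩ = h.toHom a * f φ
  induction hf' using AddSubgroup.closure_induction with
  | mem f hx =>
    obtain ⟨x, b, rfl⟩ := hx
    show h.toHom (a * φ.1 x) * b = h.toHom a * (h.toHom (φ.1 x) * b)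
    rw [map_mul, mul_assoc]
  | zero => exact (mul_zero _).symm
  | add f f' h₁ h₂ i₁ i₂ =>
    rw [AddMonoidHom.add_apply, AddMonoidHom.add_apply, i₁ h₁, i₂ h₂, mul_add]
  | neg f h₁ i₁ => rw [AddMonoidHom.neg_apply, AddMonoidHom.neg_apply, i₁ h₁, mul_neg]

/-- Precomposition of functionals with an adjointable operator. -/
def precomp (V : N.adjointable.carrier) : N.Θ →+ N.Θ :=
  AddMonoidHom.mk' (fun φ => ⟨φ.1.comp V.1, V.2.2 φ.1 φ.2⟩) (fun _ _ => rfl)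

theorem precomp_add (V W : N.adjointable.carrier) (φ : N.Θ) :
    N.precomp (V + W) φ = N.precomp V φ + N.precomp W φ :=
  Subtype.ext (AddMonoidHom.ext fun x => map_add φ.1 (V.1 x) (W.1 x))

/-- Precomposition with φ ↦ φ ∘ V carries x ⊗ b to Vx ⊗ b. Defining V ⊗ 1 this way leaves no tensor
relations to check. -/
theorem comp_precomp_mem (V : N.adjointable.carrier) {f : N.Θ →+ B.carrier}
    (hf : f ∈ N.inducedGroup h) : f.comp (N.precomp V) ∈ N.inducedGroup h :=
  mem_of_inducedGroup hf (AddMonoidHom.compHom.flip (N.precomp V)) _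
    fun x b => N.inducedTmul_mem h (V.1 x) b

/-- The operator `V ⊗ 1` on `N ⊗_h B`. -/
def inducedOperator (V : N.adjointable.carrier) : AddMonoid.End (N.induced h).carrier :=
  AddMonoidHom.mk' (fun f : N.inducedGroup h =>
    (⟨f.1.comp (N.precomp V), N.comp_precomp_mem h V f.2⟩ : N.inducedGroup h)) (fun _ _ => rfl)

/-- The homomorphism `L_A(N) → L_B(N ⊗_h B)`, `V ↦ V ⊗ 1`. -/
def inducedHom : GHom N.adjointable (N.induced h).adjointable where
  toHom :=
    { toFun := fun V => ⟨N.inducedOperator h V, fun _ _ => rfl, fun χ hχ => by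
        refine map_mem_of_mem_closure (AddMonoidHom.compHom.flip
          (N.inducedOperator h V : N.inducedGroup h →+ N.inducedGroup h)) hχ ?_
        rintro _ ⟨b, φ, rfl⟩
        exact N.functional_mem h b (N.precomp V φ)⟩
      map_mul' := fun V W => rfl
      map_zero' := Subtype.ext <| AddMonoidHom.ext fun f => Subtype.ext <|
        AddMonoidHom.ext fun φ => by
          show f.1 (N.precomp 0 φ) = 0
          rw [← map_zero f.1]
          exact congrArg f.1 (Subtype.ext (AddMonoidHom.ext fun x => map_zero φ.1))
      map_add' := fun V W => Subtype.ext <| AddMonoidHom.ext fun f => Subtype.ext <|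
        AddMonoidHom.ext fun φ => by
          show f.1 (N.precomp (V + W) φ) = f.1 (N.precomp V φ) + f.1 (N.precomp W φ)
          rw [precomp_add, map_add] }
  map_act g V := Subtype.ext <| AddMonoidHom.ext fun f => Subtype.ext <|
    AddMonoidHom.ext fun φ => by
      show f.1 (N.precomp (N.adjointable.act g V) φ) = B.act g (B.act g⁻¹
        (f.1 (N.actFunctional g⁻¹⁻¹ (N.precomp V (N.actFunctional g⁻¹ φ)))))
      rw [B.act_act_inv]
      refine congrArg f.1 (Subtype.ext (AddMonoidHom.ext fun x => ?_))
      show φ.1 (N.act g (V.1 (N.act g⁻¹ x))) = A.act g⁻¹⁻¹ (A.act g⁻¹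
        (φ.1 (N.act g⁻¹⁻¹ (V.1 (N.act g⁻¹⁻¹⁻¹ x)))))
      rw [inv_inv, A.act_act_inv]

/-- The operator θ_{η,φ} ⊗ 1 is f ↦ η ⊗ f(φ). This is not visibly elementary, as B has no unit, but
cofullness lets factors of η move across the tensor sign. -/
theorem inducedHom_compact (hN : N.Cofull) (V : N.adjointable.carrier)
    (hV : V.1 ∈ N.compactSubring) :
    ((N.inducedHom h).toHom V).1 ∈ (N.induced h).compactSubring := by
  obtain ⟨V, hV'⟩ := V
  have hc : V ∈ AddSubgroup.closure N.elementary := hV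
  induction hc using AddSubgroup.closure_induction with
  | mem V hx =>
    obtain ⟨η, φ, hφ, rfl⟩ := hx
    -- Φ(η) is θ_{η,φ} ⊗ 1 as an additive function of η alone, so that η may be replaced by
    -- generators ξ a b ψ(ζ).
    let Φ : N.carrier →+ AddMonoid.End (N.induced h).carrier := AddMonoidHom.mk'
      (fun η => AddMonoidHom.mk' (fun f => N.tmul h η (f.1 ⟨φ, hφ⟩)) (fun f f' =>
        Subtype.ext (AddMonoidHom.ext fun ψ => mul_add _ (f.1 ⟨φ, hφ⟩) (f'.1 ⟨φ, hφ⟩))))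
      (fun η η' => AddMonoidHom.ext fun f => map_add (N.tmulLeft h _) η η')
    have hΦ : N.inducedOperator h ⟨N.theta η φ, hV'⟩ = Φ η := by
      refine AddMonoidHom.ext fun f => Subtype.ext (AddMonoidHom.ext fun ψ => ?_)
      show f.1 _ = h.toHom (ψ.1 η) * f.1 ⟨φ, hφ⟩
      rw [← induced_map_smul]
      exact congrArg f.1 (Subtype.ext (AddMonoidHom.ext fun x => N.map_smul ψ.1 ψ.2 _ _))
    show N.inducedOperator h ⟨N.theta η φ, hV'⟩ ∈ (N.induced h).compactSubring
    rw [hΦ]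
    refine hN.map_mem_of_smul (S := (N.induced h).compactSubring.toAddSubgroup) Φ
      (fun ξ a b ζ ψ hψ => ?_) η
    -- For η = ξ a b ψ(ζ), the factor h(b) stays in the vector and h(ψ(ζ)) becomes the coefficient
    -- of the functional.
    refine AddSubgroup.subset_closure ⟨N.tmul h (N.smul ξ a) (h.toHom b),
      N.inducedFunctional h (h.toHom (ψ ζ)) ⟨φ, hφ⟩, N.functional_mem h _ _,
      AddMonoidHom.ext fun f => ?_⟩
    show N.tmul h (N.smul (N.smul (N.smul ξ a) b) (ψ ζ)) (f.1 ⟨φ, hφ⟩) =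
      (N.induced h).smul (N.tmul h (N.smul ξ a) (h.toHom b)) (h.toHom (ψ ζ) * f.1 ⟨φ, hφ⟩)
    rw [tmul_smul, smul_tmul, smul_tmul]
  | zero =>
    have e : (⟨0, hV'⟩ : N.adjointable.carrier) = 0 := rfl
    rw [e, map_zero]
    exact zero_mem (N.induced h).compactSubring
  | add V W h₁ h₂ i₁ i₂ =>
    have e : (⟨V + W, hV'⟩ : N.adjointable.carrier) =
      ⟨V, N.compact_mem_adjointable h₁⟩ + ⟨W, N.compact_mem_adjointable h₂⟩ := rfl
    rw [e, map_add]
    exact add_mem (S := NonUnitalSubring _) (i₁ _ h₁) (i₂ _ h₂)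
  | neg V h₁ i₁ =>
    have e : (⟨-V, hV'⟩ : N.adjointable.carrier) = -⟨V, N.compact_mem_adjointable h₁⟩ := rfl
    rw [e, map_neg]
    exact neg_mem (S := NonUnitalSubring _) (i₁ _ h₁)

end Induced

end FModule

/-! ### Rotation homotopies -/

/-- The functions `cos (π t / 2)` and `sin (π t / 2)` on the unit interval. -/
noncomputable def rotationEntry (i : Fin 2) : C(unitInterval, ℂ) where
  toFun t := ![((Real.cos (Real.pi / 2 * t) : ℝ) : ℂ), ((Real.sin (Real.pi / 2 * t) : ℝ) : ℂ)] i
  continuous_toFun := by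
    fin_cases i
    · show Continuous fun t : unitInterval => ((Real.cos (Real.pi / 2 * t) : ℝ) : ℂ)
      fun_prop
    · show Continuous fun t : unitInterval => ((Real.sin (Real.pi / 2 * t) : ℝ) : ℂ)
      fun_prop

theorem rotationEntry_sq :
    rotationEntry 0 * rotationEntry 0 + rotationEntry 1 * rotationEntry 1 = 1 := by
  ext t
  show ((Real.cos (Real.pi / 2 * t) : ℝ) : ℂ) * ((Real.cos (Real.pi / 2 * t) : ℝ) : ℂ) +
    ((Real.sin (Real.pi / 2 * t) : ℝ) : ℂ) * ((Real.sin (Real.pi / 2 * t) : ℝ) : ℂ) = 1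
  rw [← Complex.ofReal_mul, ← Complex.ofReal_mul, ← Complex.ofReal_add, ← sq, ← sq,
    Real.cos_sq_add_sin_sq, Complex.ofReal_one]

theorem rotationEntry_at_zero : rotationEntry 0 0 = 1 ∧ rotationEntry 1 0 = 0 := by
  simp [rotationEntry]

theorem rotationEntry_at_one : rotationEntry 0 1 = 0 ∧ rotationEntry 1 1 = 1 := by
  simp [rotationEntry]

/-- The two diagonal entries of a system of matrix units over `A` are homotopic by a rotation. -/
theorem homotopic_of_matrixUnits {A R : GRing.{w, u} G} (κ : Fin 2 → Fin 2 → A.carrier →+ R.carrier)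
    (κ_mul : ∀ i j l a b, κ i j a * κ j l b = κ i l (a * b))
    (κ_mul_zero : ∀ i j k l a b, j ≠ k → κ i j a * κ k l b = 0)
    (κ_act : ∀ i j g a, κ i j (A.act g a) = R.act g (κ i j a))
    (f₀ f₁ : GHom A R) (h₀ : ∀ a, f₀.toHom a = κ 0 0 a) (h₁ : ∀ a, f₁.toHom a = κ 1 1 a) :
    Homotopic f₀ f₁ := by
  -- With r = (cos, sin), the matrix (r_i r_j) is a projection of rank one at every t, moving from
  -- the first diagonal unit to the second. The homotopy places a on this projection, so no unitary
  -- of a matrix ring is needed.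
  let Φ : A.carrier →+ R.cyl.carrier := ∑ i, ∑ j,
    (((TensorProduct.mk ℤ R.carrier C(unitInterval, ℂ)).flip
      (rotationEntry i * rotationEntry j)).toAddMonoidHom.comp (κ i j))
  have hΦ : ∀ a, Φ a =
      κ 0 0 a ⊗ₜ[ℤ] (rotationEntry 0 * rotationEntry 0) +
      κ 0 1 a ⊗ₜ[ℤ] (rotationEntry 0 * rotationEntry 1) +
      (κ 1 0 a ⊗ₜ[ℤ] (rotationEntry 1 * rotationEntry 0) +
      κ 1 1 a ⊗ₜ[ℤ] (rotationEntry 1 * rotationEntry 1)) := fun a => by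
    simp only [Φ, Fin.sum_univ_two]
    rfl
  have h_eval : ∀ t a, R.evalAt t (Φ a) =
      κ 0 0 a ⊗ₜ[ℤ] (rotationEntry 0 t * rotationEntry 0 t) +
      κ 0 1 a ⊗ₜ[ℤ] (rotationEntry 0 t * rotationEntry 1 t) +
      (κ 1 0 a ⊗ₜ[ℤ] (rotationEntry 1 t * rotationEntry 0 t) +
      κ 1 1 a ⊗ₜ[ℤ] (rotationEntry 1 t * rotationEntry 1 t)) := fun t a => by
    rw [hΦ, map_add, map_add, map_add]
    rfl
  -- Inserting cos² + sin² = 1 between r_i and r_l produces the two terms which the matrix product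
  -- Φ(a) Φ(b) contributes to entry (i, l).
  have h_unit : ∀ (x : R.carrier) (i l : Fin 2),
      x ⊗ₜ[ℤ] (rotationEntry i * rotationEntry l) =
        x ⊗ₜ[ℤ] (rotationEntry i * rotationEntry 0 * (rotationEntry 0 * rotationEntry l)) +
        x ⊗ₜ[ℤ] (rotationEntry i * rotationEntry 1 * (rotationEntry 1 * rotationEntry l)) := by
    intro x i l
    rw [← TensorProduct.tmul_add]
    congr 1
    linear_combination -(rotationEntry i * rotationEntry l) * rotationEntry_sq
  have h01 : ∀ i l a b, κ i 0 a * κ 1 l b = 0 := fun i l a b => κ_mul_zero i 0 1 l a b (by decide)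
  have h10 : ∀ i l a b, κ i 1 a * κ 0 l b = 0 := fun i l a b => κ_mul_zero i 1 0 l a b (by decide)
  refine ⟨⟨⟨⟨Φ, fun a b => ?_⟩, map_zero Φ, map_add Φ⟩, fun g a => ?_⟩, fun a => ⟨?_, ?_⟩⟩
  · show Φ (a * b) = Φ a * Φ b
    rw [hΦ, hΦ, hΦ]
    simp only [add_mul, mul_add, Algebra.TensorProduct.tmul_mul_tmul, h01, h10, κ_mul,
      TensorProduct.zero_tmul]
    rw [h_unit _ 0 0, h_unit _ 0 1, h_unit _ 1 0, h_unit _ 1 1]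
    abel
  · show Φ (A.act g a) = R.tensorMap C(unitInterval, ℂ) g (Φ a)
    rw [hΦ, hΦ]
    simp only [map_add, GRing.tensorMap_tmul, κ_act]
  · show R.evalAt 0 (Φ a) = _
    rw [h_eval, rotationEntry_at_zero.1, rotationEntry_at_zero.2, h₀]
    simp
  · show R.evalAt 1 (Φ a) = _
    rw [h_eval, rotationEntry_at_one.1, rotationEntry_at_one.2, h₁]
    simp

/-! ### Corner embeddings without free summand -/

namespace FModule

variable {B : GRing.{w, u} G}

/-- The corner embedding data `B → K_B(E ⊕ B)` of a cofull module `E`. -/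
noncomputable def cornerData (E : FModule B) (hE : E.Cofull) (hB : B.Quadratik) :
    CornerData B where
  E := E
  J := PEmpty
  T := 1
  act_smul _ _ _ := Subsingleton.elim _ _
  act_functional g c := ⟨c, fun x => by
    rw [Subsingleton.elim x 0, Subsingleton.elim ((1 : G →* AddMonoid.End _) g⁻¹ 0) 0, map_zero,
      map_zero]⟩
  cofull := hE.sum ((cofull_self hB).sum (eq_top_iff.2 fun x _ => by
    rw [Subsingleton.elim x 0]
    exact zero_mem _))

end FModule

/-! ### Block operators on E ⊕ H_B and Morita contexts -/

namespace CornerData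

variable {A B : GRing.{w, u} G} (c : CornerData B)

/-- Operators on the summand `E` of `E ⊕ H_B`. -/
noncomputable def blockEE : AddMonoid.End c.E.carrier →+ AddMonoid.End c.module.carrier :=
  AddMonoidHom.mk' (fun p => AddMonoidHom.mk'
    (fun x : c.E.carrier × (B.carrier × (c.J →₀ B.carrier)) =>
      ((p x.1, 0) : c.E.carrier × (B.carrier × (c.J →₀ B.carrier))))
    (fun x y => Prod.ext (map_add p x.1 y.1) (add_zero _).symm))
    (fun _ _ => AddMonoidHom.ext fun _ => Prod.ext rfl (add_zero _).symm)

/-- Operators from the distinguished summand `B` of `E ⊕ H_B` to `E`. -/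
noncomputable def blockEB : (B.carrier →+ c.E.carrier) →+ AddMonoid.End c.module.carrier :=
  AddMonoidHom.mk' (fun p => AddMonoidHom.mk'
    (fun x : c.E.carrier × (B.carrier × (c.J →₀ B.carrier)) =>
      ((p x.2.1, 0) : c.E.carrier × (B.carrier × (c.J →₀ B.carrier))))
    (fun x y => Prod.ext (map_add p x.2.1 y.2.1) (add_zero _).symm))
    (fun _ _ => AddMonoidHom.ext fun _ => Prod.ext rfl (add_zero _).symm)

/-- Operators from the summand `E` of `E ⊕ H_B` to the distinguished summand `B`. -/
noncomputable def blockBE : (c.E.carrier →+ B.carrier) →+ AddMonoid.End c.module.carrier :=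
  AddMonoidHom.mk' (fun p => AddMonoidHom.mk'
    (fun x : c.E.carrier × (B.carrier × (c.J →₀ B.carrier)) =>
      ((0, (p x.1, 0)) : c.E.carrier × (B.carrier × (c.J →₀ B.carrier))))
    (fun x y => Prod.ext (add_zero _).symm (Prod.ext (map_add p x.1 y.1) (add_zero _).symm)))
    (fun _ _ => AddMonoidHom.ext fun _ =>
      Prod.ext (add_zero _).symm (Prod.ext rfl (add_zero _).symm))

/-- Left multiplications on the distinguished summand `B` of `E ⊕ H_B`. -/
noncomputable def blockBB : B.carrier →+ AddMonoid.End c.module.carrier :=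
  AddMonoidHom.mk' c.operator (fun b b' => AddMonoidHom.ext fun x =>
      Prod.ext (add_zero _).symm (Prod.ext (add_mul b b' x.2.1) (add_zero _).symm))

/-- The functionals on B are the left multiplications, so `hΘ` says that φ ∘ q is a functional on B
for each φ in Θ(E). On the other summands the block vanishes. -/
theorem blockEB_adjointable (q : B.carrier →+ c.E.carrier)
    (hq : ∀ b b', q (b * b') = c.E.smul (q b) b')
    (hΘ : ∀ φ ∈ c.E.Θ, ∃ d, ∀ b, φ (q b) = d * b) :
    c.blockEB q ∈ c.module.adjointableSubring := by
  refine ⟨fun x b => Prod.ext (hq x.2.1 b) ?_, ?_⟩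
  · exact (DFunLike.congr_fun (map_zero ((FModule.self B).sum (FModule.free B c.J c.T c.act_smul
      c.act_functional)).smul) b).symm
  · rintro _ ⟨φ, hφ, ψ, hψ, rfl⟩
    obtain ⟨d, hd⟩ := hΘ φ hφ
    refine ⟨0, zero_mem _, (AddMonoidHom.mul d).coprod 0,
      ⟨_, ⟨d, rfl⟩, 0, zero_mem _, rfl⟩, AddMonoidHom.ext fun x => ?_⟩
    show φ (q x.2.1) + ψ 0 = 0 + (d * x.2.1 + 0)
    rw [map_zero ψ, hd, zero_add]

/-- A functional on E ⊕ H_B is left multiplication by some d on the distinguished summand B, so only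
the maps d r have to be functionals on E; r takes values in a ring without unit. -/
theorem blockBE_adjointable (r : c.E.carrier →+ B.carrier)
    (hr : ∀ ξ b, r (c.E.smul ξ b) = r ξ * b)
    (hΘ : ∀ b, (AddMonoidHom.mulLeft b).comp r ∈ c.E.Θ) :
    c.blockBE r ∈ c.module.adjointableSubring := by
  refine ⟨fun x b => Prod.ext ?_ (Prod.ext (hr x.1 b) ?_), ?_⟩
  · exact (DFunLike.congr_fun (map_zero c.E.smul) b).symm
  · exact (DFunLike.congr_fun (map_zero (FModule.freeSmul B c.J)) b).symm
  · rintro _ ⟨φ, hφ, _, ⟨_, ⟨d, rfl⟩, ω, hω, rfl⟩, rfl⟩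
    refine ⟨_, hΘ d, 0, zero_mem _, AddMonoidHom.ext fun x => ?_⟩
    show φ 0 + (d * r x.1 + ω 0) = d * r x.1 + 0
    rw [map_zero, map_zero, zero_add]

end CornerData

/-- A Morita context which links the homomorphisms `w : A → K_B(E)` and `h : A → B` by
off-diagonal entries `u : A → L_B(B, E)` and `v : A → L_B(E, B)`. -/
structure Linking {A B : GRing.{w, u} G} (E : FModule B) (w : GHom A E.compact)
    (h : GHom A B) where
  u : A.carrier →+ B.carrier →+ E.carrier
  v : A.carrier →+ E.carrier →+ B.carrier
  u_smul : ∀ a b b', u a (b * b') = E.smul (u a b) b'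
  u_functional : ∀ a, ∀ φ ∈ E.Θ, ∃ d, ∀ b, φ (u a b) = d * b
  v_smul : ∀ a ξ b, v a (E.smul ξ b) = v a ξ * b
  v_functional : ∀ a b, (AddMonoidHom.mulLeft b).comp (v a) ∈ E.Θ
  v_u : ∀ a a' b, v a (u a' b) = h.toHom (a * a') * b
  u_v : ∀ a a' ξ, u a (v a' ξ) = (w.toHom (a * a')).1 ξ
  w_u : ∀ a a' b, (w.toHom a).1 (u a' b) = u (a * a') b
  u_h : ∀ a a' b, u a (h.toHom a' * b) = u (a * a') b
  v_w : ∀ a a' ξ, v a ((w.toHom a').1 ξ) = v (a * a') ξ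
  h_v : ∀ a a' ξ, h.toHom a * v a' ξ = v (a * a') ξ
  u_act : ∀ g a b, u (A.act g a) b = E.act g (u a (B.act g⁻¹ b))
  v_act : ∀ g a ξ, v (A.act g a) ξ = B.act g (v a (E.act g⁻¹ ξ))

namespace Linking

variable {A B : GRing.{w, u} G} (c : CornerData B) {w : GHom A c.E.compact} {h : GHom A B}
  (l : Linking c.E w h)

/-- The matrix units on `E ⊕ H_B` of a Morita context. -/
noncomputable def unit : Fin 2 → Fin 2 → A.carrier →+ AddMonoid.End c.module.carrier :=
  ![![c.blockEE.comp ((AddSubgroupClass.subtype c.E.compactSubring).comp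
        (w.toHom : A.carrier →+ c.E.compact.carrier)), c.blockEB.comp l.u],
    ![c.blockBE.comp l.v, c.blockBB.comp (h.toHom : A.carrier →+ B.carrier)]]

theorem unit_mul (i j k : Fin 2) (a b : A.carrier) :
    l.unit c i j a * l.unit c j k b = l.unit c i k (a * b) := by
  refine AddMonoidHom.ext fun x => ?_
  fin_cases i <;> fin_cases j <;> fin_cases k
  · refine Prod.ext (?_ : (w.toHom a).1 ((w.toHom b).1 x.1) = (w.toHom (a * b)).1 x.1) rfl
    rw [map_mul]
    rfl
  · exact Prod.ext (l.w_u a b x.2.1) rfl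
  · exact Prod.ext (l.u_v a b x.1) rfl
  · exact Prod.ext (l.u_h a b x.2.1) rfl
  · exact Prod.ext rfl (Prod.ext (l.v_w a b x.1) rfl)
  · exact Prod.ext rfl (Prod.ext (l.v_u a b x.2.1) rfl)
  · exact Prod.ext rfl (Prod.ext (l.h_v a b x.1) rfl)
  · refine Prod.ext rfl (Prod.ext
      (?_ : h.toHom a * (h.toHom b * x.2.1) = h.toHom (a * b) * x.2.1) rfl)
    rw [map_mul, mul_assoc]

theorem unit_mul_zero (i j k m : Fin 2) (a b : A.carrier) (hjk : j ≠ k) :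
    l.unit c i j a * l.unit c k m b = 0 := by
  refine AddMonoidHom.ext fun x => ?_
  fin_cases i <;> fin_cases j <;> fin_cases k <;> fin_cases m <;> first
    | exact absurd rfl hjk
    | exact Prod.ext (map_zero ((w.toHom a).1 : c.E.carrier →+ c.E.carrier)) rfl
    | exact Prod.ext (map_zero (l.u a)) rfl
    | exact Prod.ext rfl (Prod.ext (map_zero (l.v a)) rfl)
    | exact Prod.ext rfl (Prod.ext (mul_zero (h.toHom a)) rfl)

theorem unit_act (i j : Fin 2) (g : G) (a : A.carrier) :
    l.unit c i j (A.act g a) = c.module.endRing.act g (l.unit c i j a) := by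
  refine AddMonoidHom.ext fun x => ?_
  have h₀ : c.E.act g 0 = 0 := map_zero (c.E.act g : c.E.carrier →+ c.E.carrier)
  have h₁ : B.act g 0 = 0 := map_zero (B.act g)
  have h₂ : c.T g 0 = 0 := map_zero (c.T g : (c.J →₀ B.carrier) →+ (c.J →₀ B.carrier))
  fin_cases i <;> fin_cases j
  · refine Prod.ext (?_ : (w.toHom (A.act g a)).1 x.1 =
      c.E.act g ((w.toHom a).1 (c.E.act g⁻¹ x.1))) (Prod.ext h₁.symm h₂.symm)
    rw [w.map_act]
    rfl
  · exact Prod.ext (l.u_act g a x.2.1) (Prod.ext h₁.symm h₂.symm)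
  · exact Prod.ext h₀.symm (Prod.ext (l.v_act g a x.1) h₂.symm)
  · refine Prod.ext h₀.symm (Prod.ext (?_ : h.toHom (A.act g a) * x.2.1 =
      B.act g (h.toHom a * B.act g⁻¹ x.2.1)) h₂.symm)
    rw [map_mul, B.act_act_inv, h.map_act]

/-- Only the entry (1, 1), the corner embedding composed with h, is compact from the outset. As A is
quadratik, the entries at products ab suffice, and these factor through a compact entry and an
adjointable one. Hence the off-diagonal maps of a Morita context need only be adjointable. -/
theorem unit_compact (hA : A.Quadratik) (hB : B.Quadratik) (i j : Fin 2) (a : A.carrier) :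
    l.unit c i j a ∈ c.module.compactSubring := by
  have h11 : ∀ a, l.unit c 1 1 a ∈ c.module.compactSubring :=
    fun a => c.operator_mem hB (h.toHom a)
  have h01 : ∀ a, l.unit c 0 1 a ∈ c.module.adjointableSubring :=
    fun a => c.blockEB_adjointable (l.u a) (l.u_smul a) (l.u_functional a)
  have h10 : ∀ a, l.unit c 1 0 a ∈ c.module.adjointableSubring :=
    fun a => c.blockBE_adjointable (l.v a) (l.v_smul a) (l.v_functional a)
  have h_prod : ∀ i j, (∀ a b, l.unit c i j (a * b) ∈ c.module.compactSubring) →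
      ∀ a, l.unit c i j a ∈ c.module.compactSubring := by
    intro i j hab a
    refine map_mem_of_mem_closure (S := c.module.compactSubring.toAddSubgroup) (l.unit c i j)
      (hA ▸ AddSubgroup.mem_top a) ?_
    rintro _ ⟨a, b, rfl⟩
    exact hab a b
  have h01' : ∀ a, l.unit c 0 1 a ∈ c.module.compactSubring := h_prod 0 1 fun a b => by
    rw [← l.unit_mul c 0 1 1]
    exact c.module.adjointable_mul_compact (h01 a) (h11 b)
  have h10' : ∀ a, l.unit c 1 0 a ∈ c.module.compactSubring := h_prod 1 0 fun a b => by
    rw [← l.unit_mul c 1 1 0]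
    exact c.module.compact_mul_adjointable (h11 a) (h10 b)
  have h00' : ∀ a, l.unit c 0 0 a ∈ c.module.compactSubring := h_prod 0 0 fun a b => by
    rw [← l.unit_mul c 0 1 0]
    exact c.module.compact_mul_adjointable (h01' a) (h10 b)
  fin_cases i <;> fin_cases j
  · exact h00' a
  · exact h01' a
  · exact h10' a
  · exact h11 a

/-- The two homomorphisms of a Morita context become homotopic in `K_B(E ⊕ H_B)`. -/
theorem homotopic (l : Linking c.E w h) (hA : A.Quadratik) (hB : B.Quadratik) (f : GHom A c.module.compact)
    (hf : ∀ a, (f.toHom a).1 = c.blockEE (w.toHom a).1) :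
    Homotopic f (h.comp (c.embedding hB)) := by
  let κ : Fin 2 → Fin 2 → A.carrier →+ c.module.compact.carrier := fun i j => AddMonoidHom.mk'
    (fun a => ⟨l.unit c i j a, l.unit_compact c hA hB i j a⟩)
    (fun a b => Subtype.ext (map_add (l.unit c i j) a b))
  exact homotopic_of_matrixUnits κ
    (fun i j k a b => Subtype.ext (l.unit_mul c i j k a b))
    (fun i j k m a b hjk => Subtype.ext (l.unit_mul_zero c i j k m a b hjk))
    (fun i j g a => Subtype.ext (l.unit_act c i j g a)) _ _
    (fun a => Subtype.ext (hf a)) (fun _ => rfl)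

end Linking

/-! ### Pushing corner embeddings forward along ring homomorphisms -/

namespace FModule

variable {A B : GRing.{w, u} G}

/-- The ring `A` as a retract of a functional module. -/
structure Retract (N : FModule A) where
  ι : A.carrier →+ N.carrier
  π : N.carrier →+ A.carrier
  ι_mul : ∀ a b, ι (a * b) = N.smul (ι a) b
  ι_act : ∀ g a, ι (A.act g a) = N.act g (ι a)
  π_act : ∀ g x, π (N.act g x) = A.act g (π x)
  π_ι : ∀ a, π (ι a) = a
  π_mem : ∀ a, (AddMonoidHom.mulLeft a).comp π ∈ N.Θ

namespace Retract

/-- The quadratik ring `A` as a retract of itself. -/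
def self (A : GRing.{w, u} G) : Retract (self A) where
  ι := AddMonoidHom.id _
  π := AddMonoidHom.id _
  ι_mul _ _ := rfl
  ι_act _ _ := rfl
  π_act _ _ := rfl
  π_ι _ := rfl
  π_mem a := ⟨a, rfl⟩

variable {N : FModule A} (r : Retract N)

/-- The functional `x ↦ a π(x)`. -/
def functional : A.carrier →+ N.Θ :=
  AddMonoidHom.mk' (fun a => ⟨_, r.π_mem a⟩) (fun a b => Subtype.ext (AddMonoidHom.ext fun x =>
    add_mul a b (r.π x)))

theorem act_functional (g : G) (a : A.carrier) :
    N.actFunctional g (r.functional a) = r.functional (A.act g a) :=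
  Subtype.ext (AddMonoidHom.ext fun x => by
    show A.act g (a * r.π (N.act g⁻¹ x)) = A.act g a * r.π x
    rw [r.π_act, map_mul, A.act_act_inv])

/-- For a retract `A` of `N`, the homomorphisms `a ↦ ι a π ⊗ 1` and `h` are linked by a Morita
context. -/
def linking (h : GHom A B) (hN : N.Cofull) (p : GHom A N.compact)
    (hp : ∀ a x, (p.toHom a).1 x = r.ι (a * r.π x)) :
    Linking (N.induced h)
      (p.comp (compactRestrict (N.inducedHom h) (N.inducedHom_compact h hN))) h where
  u := AddMonoidHom.mk'
    (fun a => AddMonoidHom.mk' (fun b => N.tmul h (r.ι a) b) (fun b b' =>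
      Subtype.ext (AddMonoidHom.ext fun φ => mul_add _ b b')))
    (fun a a' => AddMonoidHom.ext fun b => by
      show N.tmulLeft h b (r.ι (a + a')) = N.tmulLeft h b (r.ι a) + N.tmulLeft h b (r.ι a')
      rw [map_add, map_add])
  -- On generators this is x ⊗ b ↦ h(a π(x)) b. Since elements of the induced module are functions
  -- on Θ(N), evaluating them at the functional a π is automatically well defined.
  v := AddMonoidHom.mk'
    (fun a => AddMonoidHom.mk' (fun f : N.inducedGroup h => f.1 (r.functional a))
      (fun f f' => rfl))
    (fun a a' => AddMonoidHom.ext fun f => by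
      show f.1 (r.functional (a + a')) = f.1 (r.functional a) + f.1 (r.functional a')
      rw [map_add, map_add])
  u_smul a b b' := (N.tmul_smul h (r.ι a) b b').symm
  u_functional a χ hχ := by
    have hχ' : χ ∈ AddSubgroup.closure {χ | ∃ b φ, χ = N.inducedFunctional h b φ} := hχ
    show ∃ d, ∀ b, χ (N.tmul h (r.ι a) b) = d * b
    induction hχ' using AddSubgroup.closure_induction with
    | mem χ hx =>
      obtain ⟨c, φ, rfl⟩ := hx
      exact ⟨c * h.toHom (φ.1 (r.ι a)), fun b => (mul_assoc _ _ _).symm⟩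
    | zero => exact ⟨0, fun b => (zero_mul b).symm⟩
    | add χ ψ h₁ h₂ i₁ i₂ =>
      obtain ⟨d, hd⟩ := i₁ h₁
      obtain ⟨e, he⟩ := i₂ h₂
      exact ⟨d + e, fun b => (congrArg₂ (· + ·) (hd b) (he b)).trans (add_mul _ _ _).symm⟩
    | neg χ h₁ i₁ =>
      obtain ⟨d, hd⟩ := i₁ h₁
      exact ⟨-d, fun b => (congrArg Neg.neg (hd b)).trans (neg_mul _ _).symm⟩
  v_smul _ _ _ := rfl
  v_functional a b := N.functional_mem h b (r.functional a)
  v_u a a' b := by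
    show h.toHom (a * r.π (r.ι a')) * b = h.toHom (a * a') * b
    rw [r.π_ι]
  u_v a a' f := Subtype.ext (AddMonoidHom.ext fun φ => by
    show h.toHom (φ.1 (r.ι a)) * f.1 (r.functional a') = f.1 (N.precomp _ φ)
    -- The scalar h(φ(ι a)) is absorbed into the functional; it remains to compare φ(ι a) a' π with
    -- φ ∘ p(a a').
    rw [← induced_map_smul]
    refine congrArg f.1 (Subtype.ext (AddMonoidHom.ext fun x => ?_))
    show φ.1 (r.ι a) * (a' * r.π x) = φ.1 ((p.toHom (a * a')).1 x)
    rw [hp, mul_assoc, r.ι_mul, N.map_smul φ.1 φ.2])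
  w_u a a' b := by
    show N.tmul h ((p.toHom a).1 (r.ι a')) b = N.tmul h (r.ι (a * a')) b
    rw [hp, r.π_ι]
  u_h a a' b := by
    show N.tmul h (r.ι a) (h.toHom a' * b) = N.tmul h (r.ι (a * a')) b
    rw [r.ι_mul, smul_tmul]
  v_w a a' f := by
    show f.1 (N.precomp _ (r.functional a)) = f.1 (r.functional (a * a'))
    refine congrArg f.1 (Subtype.ext (AddMonoidHom.ext fun x => ?_))
    show a * r.π ((p.toHom a').1 x) = a * a' * r.π x
    rw [hp, r.π_ι, mul_assoc]
  h_v a a' f := by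
    show h.toHom a * f.1 (r.functional a') = f.1 (r.functional (a * a'))
    rw [← induced_map_smul]
    exact congrArg f.1 (Subtype.ext (AddMonoidHom.ext fun x => (mul_assoc _ _ _).symm))
  u_act g a b := by
    refine Subtype.ext (?_ : N.inducedTmul h (r.ι (A.act g a)) b =
      N.inducedActAux g (N.inducedTmul h (r.ι a) (B.act g⁻¹ b)))
    rw [inducedActAux_tmul, B.act_act_inv, r.ι_act]
  v_act g a f := by
    show f.1 (r.functional (A.act g a)) =
      B.act g (B.act g⁻¹ (f.1 (N.actFunctional g⁻¹⁻¹ (r.functional a))))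
    rw [B.act_act_inv, inv_inv, act_functional]

end Retract

section Push

variable (N : FModule A) (hN : N.Cofull) (h : GHom A B) (hB : B.Quadratik)

/-- The corner embedding `B → K_B((N ⊗_h B) ⊕ B)`. -/
noncomputable def pushCorner : CornerData B := (N.induced h).cornerData (hN.induced h) hB

/-- The homomorphism `L_A(N) → L_B((N ⊗_h B) ⊕ B)`. -/
noncomputable def pushAdjointable :
    GHom N.adjointable (N.pushCorner hN h hB).module.adjointable :=
  (N.inducedHom h).comp ((N.induced h).extendZero _)

theorem pushAdjointable_compact (V : N.adjointable.carrier) (hV : V.1 ∈ N.compactSubring) :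
    ((N.pushAdjointable hN h hB).toHom V).1 ∈ (N.pushCorner hN h hB).module.compactSubring :=
  (N.induced h).extendZero_compact _ _ (N.inducedHom_compact h hN V hV)

/-- The homomorphism `K_A(N) → K_B((N ⊗_h B) ⊕ B)`. -/
noncomputable def pushCompact : GHom N.compact (N.pushCorner hN h hB).module.compact :=
  compactRestrict (N.pushAdjointable hN h hB) (N.pushAdjointable_compact hN h hB)

/-- The two sides are the diagonal blocks of the Morita context `r.linking`. The cases of interest
are N = E ⊕ H_A with p the corner embedding, and N = A with p the left multiplication. -/
theorem Retract.homotopic {N : FModule A} (r : Retract N) (hN : N.Cofull) (h : GHom A B)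
    (hA : A.Quadratik) (hB : B.Quadratik) (p : GHom A N.compact)
    (hp : ∀ a x, (p.toHom a).1 x = r.ι (a * r.π x)) :
    Homotopic (p.comp (N.pushCompact hN h hB)) (h.comp ((N.pushCorner hN h hB).embedding hB)) :=
  Linking.homotopic (N.pushCorner hN h hB) (r.linking h hN p hp) hA hB _ (fun _ => rfl)

end Push

end FModule

/-- The ring `A` as a retract of `E ⊕ H_A`. -/
noncomputable def CornerData.retract {A : GRing.{w, u} G} (c : CornerData A) :
    c.module.Retract where
  ι := (AddMonoidHom.inr c.E.carrier (A.carrier × (c.J →₀ A.carrier))).comp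
    (AddMonoidHom.inl A.carrier (c.J →₀ A.carrier))
  π := (AddMonoidHom.fst A.carrier (c.J →₀ A.carrier)).comp
    (AddMonoidHom.snd c.E.carrier (A.carrier × (c.J →₀ A.carrier)))
  ι_mul a b := Prod.ext (DFunLike.congr_fun (map_zero c.E.smul) b).symm
    (Prod.ext rfl (DFunLike.congr_fun (map_zero (FModule.freeSmul A c.J)) b).symm)
  ι_act g a := Prod.ext (map_zero (c.E.act g : c.E.carrier →+ c.E.carrier)).symm
    (Prod.ext rfl (map_zero (c.T g : (c.J →₀ A.carrier) →+ (c.J →₀ A.carrier))).symm)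
  π_act _ _ := rfl
  π_ι _ := rfl
  π_mem a := ⟨0, zero_mem _, (AddMonoidHom.mul a).coprod 0, ⟨_, ⟨a, rfl⟩, 0, zero_mem _, rfl⟩,
    AddMonoidHom.ext fun x => by
      show a * x.2.1 = 0 + (a * x.2.1 + 0)
      rw [zero_add, add_zero]⟩

/-! ### Split exact sequences -/

namespace FModule

variable {A : GRing.{w, u} G}

/-- The homomorphism `A → K_A(A)` by left multiplication. -/
def leftMul (hA : A.Quadratik) : GHom A (self A).compact where
  toHom :=
    { toFun := fun a => ⟨AddMonoidHom.mulLeft a, by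
        refine map_mem_of_mem_closure (S := (self A).compactSubring.toAddSubgroup)
          (AddMonoidHom.mul : A.carrier →+ A.carrier →+ A.carrier)
          (hA ▸ AddSubgroup.mem_top a) ?_
        rintro _ ⟨a, b, rfl⟩
        exact AddSubgroup.subset_closure ⟨a, _, ⟨b, rfl⟩,
          AddMonoidHom.ext fun x => mul_assoc a b x⟩⟩
      map_mul' := fun a b => Subtype.ext (AddMonoidHom.ext fun x => mul_assoc a b x)
      map_zero' := Subtype.ext (AddMonoidHom.ext fun x => zero_mul x)
      map_add' := fun a b => Subtype.ext (AddMonoidHom.ext fun x => add_mul a b x) }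
  map_act g a := Subtype.ext (AddMonoidHom.ext fun x => by
    show A.act g a * x = A.act g (a * A.act g⁻¹ x)
    rw [map_mul, A.act_act_inv])

end FModule

namespace SplitExact

variable {B M A : GRing.{w, u} G} (S : SplitExact B M A)

theorem f_j (b : B.carrier) : S.f.toHom (S.j.toHom b) = 0 := (S.exact _).2 ⟨b, rfl⟩

theorem exists_mul (m : M.carrier) (b : B.carrier) :
    ∃ b', S.j.toHom b' = m * S.j.toHom b :=
  (S.exact _).1 (by rw [map_mul, S.f_j, mul_zero])

/-- The left multiplication of `M` on its ideal `B`. -/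
noncomputable def leftAction (m : M.carrier) (b : B.carrier) : B.carrier :=
  (S.exists_mul m b).choose

theorem j_leftAction (m : M.carrier) (b : B.carrier) :
    S.j.toHom (S.leftAction m b) = m * S.j.toHom b := (S.exists_mul m b).choose_spec

/-- The homomorphism `M → L_B(B)` by left multiplication. -/
noncomputable def multiplier : GHom M (FModule.self B).adjointable where
  toHom :=
    { toFun := fun m => ⟨AddMonoidHom.mk' (S.leftAction m) (fun b b' => S.injective (by
          simp only [map_add, j_leftAction, mul_add])),
        fun b b' => S.injective (by
          show S.j.toHom (S.leftAction m (b * b')) = S.j.toHom (S.leftAction m b * b')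
          simp only [map_mul, j_leftAction, mul_assoc]), by
        rintro _ ⟨c, rfl⟩
        -- Since B is also a right ideal, c m is an element d of B, and the functional b ↦ c (m b)
        -- is left multiplication by d.
        obtain ⟨d, hd⟩ := (S.exact (S.j.toHom c * m)).1 (by rw [map_mul, S.f_j, zero_mul])
        refine ⟨d, AddMonoidHom.ext fun b => S.injective ?_⟩
        show S.j.toHom (d * b) = S.j.toHom (c * S.leftAction m b)
        simp only [map_mul, j_leftAction, hd, mul_assoc]⟩
      map_mul' := fun m m' => Subtype.ext (AddMonoidHom.ext fun b => S.injective (by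
        show S.j.toHom (S.leftAction (m * m') b) =
          S.j.toHom (S.leftAction m (S.leftAction m' b))
        simp only [j_leftAction, mul_assoc]))
      map_zero' := Subtype.ext (AddMonoidHom.ext fun b => S.injective (by
        show S.j.toHom (S.leftAction 0 b) = S.j.toHom 0
        rw [j_leftAction, zero_mul, map_zero]))
      map_add' := fun m m' => Subtype.ext (AddMonoidHom.ext fun b => S.injective (by
        show S.j.toHom (S.leftAction (m + m') b) =
          S.j.toHom (S.leftAction m b + S.leftAction m' b)
        simp only [map_add, j_leftAction, add_mul])) }
  map_act g m := Subtype.ext (AddMonoidHom.ext fun b => S.injective (by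
    show S.j.toHom (S.leftAction (M.act g m) b) =
      S.j.toHom (B.act g (S.leftAction m (B.act g⁻¹ b)))
    rw [S.j.map_act, j_leftAction, j_leftAction, map_mul, S.j.map_act, M.act_act_inv]))

/-- This compatibility makes M → L_B(B) carry the ideal B into the compact operators, as is needed
to lift into a square. -/
theorem multiplier_j (hB : B.Quadratik) (b : B.carrier) :
    S.multiplier.toHom (S.j.toHom b) =
      (FModule.self B).compactIncl.toHom ((FModule.leftMul hB).toHom b) :=
  Subtype.ext (AddMonoidHom.ext fun x => S.injective (by
    show S.j.toHom (S.leftAction (S.j.toHom b) x) = S.j.toHom (b * x)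
    rw [j_leftAction, map_mul]))

end SplitExact

/-- The split exact sequence `0 → B → M □_s A → A → 0`. -/
def squareExact {B M A : GRing.{w, u} G} (i : GHom B M) (s : GHom A M)
    (h_left : ∀ m b, ∃ b', m * i.toHom b = i.toHom b')
    (h_right : ∀ b m, ∃ b', i.toHom b * m = i.toHom b') (hi : Function.Injective i.toHom) :
    SplitExact B (GRing.square i s h_left h_right) A where
  j :=
    { toHom :=
        { toFun := fun b => ⟨(i.toHom b, 0), b, by
            show i.toHom b = s.toHom 0 + i.toHom b
            rw [map_zero, zero_add]⟩
          map_mul' := fun b b' => Subtype.ext (Prod.ext (map_mul i.toHom b b') (mul_zero _).symm)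
          map_zero' := Subtype.ext (Prod.ext (map_zero i.toHom) rfl)
          map_add' := fun b b' =>
            Subtype.ext (Prod.ext (map_add i.toHom b b') (add_zero _).symm) }
      map_act := fun g b => Subtype.ext (Prod.ext (i.map_act g b) (map_zero (A.act g)).symm) }
  f :=
    { toHom :=
        { toFun := fun x => x.1.2
          map_mul' := fun _ _ => rfl
          map_zero' := rfl
          map_add' := fun _ _ => rfl }
      map_act := fun _ _ => rfl }
  s :=
    { toHom :=
        { toFun := fun a => ⟨(s.toHom a, a), 0, by
            show s.toHom a = s.toHom a + i.toHom 0
            rw [map_zero, add_zero]⟩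
          map_mul' := fun a a' => Subtype.ext (Prod.ext (map_mul s.toHom a a') rfl)
          map_zero' := Subtype.ext (Prod.ext (map_zero s.toHom) rfl)
          map_add' := fun a a' => Subtype.ext (Prod.ext (map_add s.toHom a a') rfl) }
      map_act := fun g a => Subtype.ext (Prod.ext (s.map_act g a) rfl) }
  injective b b' hb := hi (congrArg
    (fun x : (GRing.square i s h_left h_right).carrier => x.1.1) hb)
  exact x := by
    constructor
    · intro hx
      obtain ⟨⟨m, a⟩, b, hb⟩ := x
      have ha : a = 0 := hx
      have hm : m = s.toHom a + i.toHom b := hb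
      refine ⟨b, Subtype.ext (Prod.ext ?_ ha.symm)⟩
      show i.toHom b = m
      rw [hm, ha, map_zero, zero_add]
    · rintro ⟨b, rfl⟩
      rfl
  split _ := rfl

/-- The homomorphism `M → L □_{s t} A` induced by a homomorphism `t : M → L` which maps the ideal
`B` of `M` to the ideal `K` of `L`. -/
def squareLift {B M A K L : GRing.{w, u} G} (S : SplitExact B M A) (t : GHom M L) (i : GHom K L)
    (h_left : ∀ m b, ∃ b', m * i.toHom b = i.toHom b')
    (h_right : ∀ b m, ∃ b', i.toHom b * m = i.toHom b')
    (k : GHom B K) (hk : ∀ b, t.toHom (S.j.toHom b) = i.toHom (k.toHom b)) :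
    GHom M (GRing.square i (S.s.comp t) h_left h_right) where
  toHom :=
    { toFun := fun m => ⟨(t.toHom m, S.f.toHom m), by
        -- The difference m - s(f(m)) lies in the kernel of f, that is, in B, and t maps it into the
        -- ideal K.
        obtain ⟨b, hb⟩ := (S.exact (m - S.s.toHom (S.f.toHom m))).1 (by
          rw [map_sub, S.split, sub_self])
        refine ⟨k.toHom b, ?_⟩
        show t.toHom m = t.toHom (S.s.toHom (S.f.toHom m)) + i.toHom (k.toHom b)
        rw [← hk, ← map_add, hb, add_sub_cancel]⟩
      map_mul' := fun m m' =>
        Subtype.ext (Prod.ext (map_mul t.toHom m m') (map_mul S.f.toHom m m'))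
      map_zero' := Subtype.ext (Prod.ext (map_zero t.toHom) (map_zero S.f.toHom))
      map_add' := fun m m' =>
        Subtype.ext (Prod.ext (map_add t.toHom m m') (map_add S.f.toHom m m')) }
  map_act g m := Subtype.ext (Prod.ext (t.map_act g m) (S.f.map_act g m))

theorem squareLift_j {B M A K L : GRing.{w, u} G} (S : SplitExact B M A) (t : GHom M L)
    (i : GHom K L) (h_left : ∀ m b, ∃ b', m * i.toHom b = i.toHom b')
    (h_right : ∀ b m, ∃ b', i.toHom b * m = i.toHom b') (hi : Function.Injective i.toHom)
    (k : GHom B K) (hk : ∀ b, t.toHom (S.j.toHom b) = i.toHom (k.toHom b)) (b : B.carrier) :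
    (squareLift S t i h_left h_right k hk).toHom (S.j.toHom b) =
      (squareExact i (S.s.comp t) h_left h_right hi).j.toHom (k.toHom b) :=
  Subtype.ext (Prod.ext (hk b) (S.f_j b))

theorem GHom.ext {A B : GRing.{w, u} G} {f g : GHom A B} (h : ∀ a, f.toHom a = g.toHom a) :
    f = g := by
  obtain ⟨f, _⟩ := f
  obtain ⟨g, _⟩ := g
  obtain rfl : f = g := NonUnitalRingHom.ext h
  rfl

/-! ### Clearing denominators in `GK^G` -/

namespace GK

variable {𝓡 : RingClass.{w, u} G}

theorem ofHom_comp {A B C : GK 𝓡} (f : GHom A.ring B.ring) (g : GHom B.ring C.ring) :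
    ofHom f ≫ ofHom g = ofHom (A := A) (B := C) (f.comp g) :=
  Quot.sound (Rel.hom_comp f g)

theorem ofHom_eq_of_homotopic {A B : GK 𝓡} {f g : GHom A.ring B.ring} (h : Homotopic f g) :
    ofHom f = ofHom g :=
  Quot.sound (Rel.homotopy f g h)

/-- The corner embedding as a morphism. -/
noncomputable def cornerHom {A : GK 𝓡} (c : CornerData A.ring) : A ⟶ corner c :=
  ofHom (c.embedding (𝓡.quadratik _ A.mem))

/-- The synthetical inverse `e⁻¹` of a corner embedding. -/
noncomputable def cornerInv {A : GK 𝓡} (c : CornerData A.ring) : corner c ⟶ A := ofExpr (Expr.cornerInv c)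

/-- The synthetical split `Δ_s` of a split exact sequence. -/
def delta {B M A : GK 𝓡} (S : SplitExact B.ring M.ring A.ring) : M ⟶ B := ofExpr (Expr.delta S)

theorem cornerHom_inv {A : GK 𝓡} (c : CornerData A.ring) :
    cornerHom c ≫ cornerInv c = 𝟙 A :=
  Quot.sound (Rel.corner_comp_inv c)

theorem cornerInv_hom {A : GK 𝓡} (c : CornerData A.ring) :
    cornerInv c ≫ cornerHom c = 𝟙 (corner c) :=
  Quot.sound (Rel.inv_comp_corner c)

theorem j_delta {B M A : GK 𝓡} (S : SplitExact B.ring M.ring A.ring) :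
    ofHom S.j ≫ delta S = 𝟙 B :=
  Quot.sound (Rel.j_delta S)

theorem delta_j {B M A : GK 𝓡} (S : SplitExact B.ring M.ring A.ring) :
    𝟙 M = delta S ≫ ofHom S.j + ofHom (B := A) S.f ≫ ofHom S.s :=
  Quot.sound (Rel.delta_j S)

/-- Compositions of corner embeddings and of embeddings of ideals in split exact sequences. -/
inductive IsCornerIdealEmbedding : ∀ {A B : GK 𝓡}, (A ⟶ B) → Prop
  | id (A : GK 𝓡) : IsCornerIdealEmbedding (𝟙 A)
  | corner {A : GK 𝓡} (c : CornerData A.ring) : IsCornerIdealEmbedding (cornerHom c)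
  | ideal {B M A : GK 𝓡} (S : SplitExact B.ring M.ring A.ring) :
      IsCornerIdealEmbedding (ofHom S.j)
  | comp {A B C : GK 𝓡} {x : A ⟶ B} {y : B ⟶ C} :
      IsCornerIdealEmbedding x → IsCornerIdealEmbedding y → IsCornerIdealEmbedding (x ≫ y)

namespace IsCornerIdealEmbedding

/-- The generators are split by the synthetical morphisms e⁻¹ and Δ. These splits are not of level 0
in general, but cancellation takes place in GK. -/
theorem mono {A B : GK 𝓡} {q : A ⟶ B} (hq : IsCornerIdealEmbedding q) : Mono q := by
  induction hq with
  | id A => infer_instance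
  | corner c => exact mono_of_mono_fac (cornerHom_inv c)
  | ideal S => exact mono_of_mono_fac (j_delta S)
  | comp _ _ i₁ i₂ => exact mono_comp _ _

theorem exists_hom {A B : GK 𝓡} {q : A ⟶ B} (hq : IsCornerIdealEmbedding q) :
    ∃ f : GHom A.ring B.ring, q = ofHom f := by
  induction hq with
  | id A => exact ⟨GHom.id A.ring, rfl⟩
  | corner c => exact ⟨_, rfl⟩
  | ideal S => exact ⟨_, rfl⟩
  | comp _ _ i₁ i₂ =>
    obtain ⟨f, rfl⟩ := i₁
    obtain ⟨g, rfl⟩ := i₂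
    exact ⟨_, ofHom_comp f g⟩

end IsCornerIdealEmbedding

/-! ### Moving denominators past level-0 morphisms -/

theorem exists_corner_square {A B : GK 𝓡} (c : CornerData A.ring) (h : GHom A.ring B.ring) :
    ∃ (B' : GK 𝓡) (q : B ⟶ B') (h' : GHom (corner c).ring B'.ring),
      IsCornerIdealEmbedding q ∧ ofHom h ≫ q = cornerHom c ≫ ofHom h' := by
  have hA := 𝓡.quadratik _ A.mem
  have hB := 𝓡.quadratik _ B.mem
  refine ⟨_, cornerHom (c.module.pushCorner c.cofull h hB), c.module.pushCompact c.cofull h hB,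
    .corner _, ?_⟩
  refine (ofHom_comp _ _).trans (Eq.trans (Eq.symm ?_) (ofHom_comp _ _).symm)
  exact ofHom_eq_of_homotopic (c.retract.homotopic c.cofull h hA hB _ (fun _ _ => rfl))

/-- The denominator is the corner embedding of C into K := K((B ⊗ C) ⊕ C) followed by the ideal
embedding of K into L □ A. Corner embeddings therefore enter even when the given denominator is an
ideal embedding. -/
theorem exists_ideal_square {B M A C : GK 𝓡} (S : SplitExact B.ring M.ring A.ring)
    (h : GHom B.ring C.ring) :
    ∃ (C' : GK 𝓡) (q : C ⟶ C') (h' : GHom M.ring C'.ring),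
      IsCornerIdealEmbedding q ∧ ofHom h ≫ q = ofHom S.j ≫ ofHom h' := by
  have hB := 𝓡.quadratik _ B.mem
  have hC := 𝓡.quadratik _ C.mem
  have hN := FModule.cofull_self hB
  let N := FModule.self B.ring
  let c := N.pushCorner hN h hC
  let t := S.multiplier.comp (N.pushAdjointable hN h hC)
  let k := (FModule.leftMul hB).comp (N.pushCompact hN h hC)
  let i := c.module.compactIncl
  have hi : Function.Injective i.toHom := c.module.compactIncl_injective
  have hk : ∀ b, t.toHom (S.j.toHom b) = i.toHom (k.toHom b) := fun b =>
    congrArg (N.pushAdjointable hN h hC).toHom (S.multiplier_j hB b)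
  let L : GK 𝓡 := ⟨c.module.adjointable, 𝓡.adjointable_mem _ C.mem _ c.cofull⟩
  -- The ideal K of L need not belong to a split exact sequence. Pairing with A along s t provides
  -- the quotient A and a split, while t and f together map M into the new ring.
  let C' : GK 𝓡 := ⟨GRing.square i (S.s.comp t) c.module.compactIncl_left
    c.module.compactIncl_right, 𝓡.square_mem (corner c).ring L.ring A.ring _ _ _ _ hi
      (corner c).mem L.mem A.mem⟩
  let S' : SplitExact (corner c).ring C'.ring A.ring := squareExact i (S.s.comp t)
    c.module.compactIncl_left c.module.compactIncl_right hi
  let h' : GHom M.ring C'.ring := squareLift S t i c.module.compactIncl_left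
    c.module.compactIncl_right k hk
  have e₁ : ofHom h ≫ cornerHom c = ofHom (B := corner c) k := by
    refine (ofHom_comp _ _).trans (Eq.symm ?_)
    -- The rotation takes place in K, before passing to C'; the rest of the square commutes
    -- strictly.
    exact ofHom_eq_of_homotopic
      ((FModule.Retract.self B.ring).homotopic hN h hB hC _ (fun _ _ => rfl))
  refine ⟨C', cornerHom c ≫ ofHom S'.j, h', .comp (.corner c) (.ideal S'), ?_⟩
  rw [← Category.assoc, e₁]
  refine (ofHom_comp _ _).trans (Eq.trans ?_ (ofHom_comp _ _).symm)
  exact congrArg ofHom (GHom.ext fun b => (squareLift_j S t i _ _ hi k hk b).symm)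

/-- The squares for single generators are pasted together; this works because the new side h' is
again a ring homomorphism. -/
theorem IsCornerIdealEmbedding.exists_hom_square {A A' : GK 𝓡} {q : A ⟶ A'}
    (hq : IsCornerIdealEmbedding q) : ∀ {B : GK 𝓡} (h : GHom A.ring B.ring),
    ∃ (B' : GK 𝓡) (q' : B ⟶ B') (h' : GHom A'.ring B'.ring),
      IsCornerIdealEmbedding q' ∧ ofHom h ≫ q' = q ≫ ofHom h' := by
  induction hq with
  | id A =>
    intro B h
    exact ⟨B, 𝟙 B, h, .id B, by rw [Category.comp_id, Category.id_comp]⟩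
  | corner c => exact exists_corner_square c
  | ideal S => exact exists_ideal_square S
  | @comp _ _ _ x y _ _ i₁ i₂ =>
    intro B h
    obtain ⟨B₁, q₁, h₁, hq₁, e₁⟩ := i₁ h
    obtain ⟨B₂, q₂, h₂, hq₂, e₂⟩ := i₂ h₁
    refine ⟨B₂, q₁ ≫ q₂, h₂, .comp hq₁ hq₂, ?_⟩
    rw [← Category.assoc, e₁, Category.assoc, e₂, Category.assoc]

/-- Two corner ideal embeddings of a ring can be completed to a commuting square. -/
theorem IsCornerIdealEmbedding.exists_common {B B₁ B₂ : GK 𝓡} {q₁ : B ⟶ B₁} {q₂ : B ⟶ B₂}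
    (h₁ : IsCornerIdealEmbedding q₁) (h₂ : IsCornerIdealEmbedding q₂) :
    ∃ (B' : GK 𝓡) (r₁ : B₁ ⟶ B') (r₂ : B₂ ⟶ B'), IsLevelZero r₁ ∧ IsLevelZero r₂ ∧
      IsCornerIdealEmbedding (q₁ ≫ r₁) ∧ q₁ ≫ r₁ = q₂ ≫ r₂ := by
  obtain ⟨f, rfl⟩ := h₂.exists_hom
  -- The square moves q₁ past q₂, itself a ring homomorphism. The map h' out of B₁ is only a
  -- homomorphism, but q₁ h' = q₂ q is again a corner ideal embedding.
  obtain ⟨B', q, h', hq, e⟩ := h₁.exists_hom_square f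
  obtain ⟨g, rfl⟩ := hq.exists_hom
  exact ⟨B', GK.ofHom h', GK.ofHom g, .ofHom h', .ofHom g, e ▸ .comp h₂ hq, e.symm⟩

theorem IsLevelZero.exists_square {A B : GK 𝓡} {h : A ⟶ B} (hh : IsLevelZero h) :
    ∀ {A' : GK 𝓡} {q : A ⟶ A'}, IsCornerIdealEmbedding q →
    ∃ (B' : GK 𝓡) (q' : B ⟶ B') (h' : A' ⟶ B'),
      IsCornerIdealEmbedding q' ∧ IsLevelZero h' ∧ h ≫ q' = q ≫ h' := by
  induction hh with
  | ofHom f =>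
    intro A' q hq
    obtain ⟨B', q', h', hq', e⟩ := hq.exists_hom_square f
    exact ⟨B', q', GK.ofHom h', hq', .ofHom h', e⟩
  | @comp _ _ _ x y _ _ i₁ i₂ =>
    intro A' q hq
    obtain ⟨B₁, q₁, h₁, hq₁, hh₁, e₁⟩ := i₁ hq
    obtain ⟨B₂, q₂, h₂, hq₂, hh₂, e₂⟩ := i₂ hq₁
    refine ⟨B₂, q₂, h₁ ≫ h₂, hq₂, .comp hh₁ hh₂, ?_⟩
    rw [Category.assoc, e₂, ← Category.assoc, e₁, Category.assoc]
  | @zero A B =>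
    intro A' q hq
    exact ⟨B, 𝟙 B, 0, .id B, .zero, by rw [Limits.zero_comp, Limits.comp_zero]⟩
  | @add _ _ x y _ _ i₁ i₂ =>
    intro A' q hq
    obtain ⟨B₁, q₁, h₁, hq₁, hh₁, e₁⟩ := i₁ hq
    obtain ⟨B₂, q₂, h₂, hq₂, hh₂, e₂⟩ := i₂ hq
    -- The summands come with different denominators, which are brought to a common one before
    -- adding.
    obtain ⟨B', r₁, r₂, hr₁, hr₂, hr, e⟩ := hq₁.exists_common hq₂
    refine ⟨B', q₁ ≫ r₁, h₁ ≫ r₁ + h₂ ≫ r₂, hr, .add (.comp hh₁ hr₁) (.comp hh₂ hr₂), ?_⟩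
    rw [Preadditive.add_comp, Preadditive.comp_add, ← Category.assoc x, e₁, e, ← Category.assoc y,
      e₂, Category.assoc, Category.assoc]
  | @neg _ _ x _ i =>
    intro A' q hq
    obtain ⟨B', q', h', hq', hh', e⟩ := i hq
    exact ⟨B', q', -h', hq', .neg hh', by rw [Preadditive.neg_comp, Preadditive.comp_neg, e]⟩

/-- Every morphism becomes level-0 after composition with a corner ideal embedding. -/
theorem exists_isLevelZero_comp {A B : GK 𝓡} (x : Expr A B) :
    ∃ (B' : GK 𝓡) (q : B ⟶ B'), IsCornerIdealEmbedding q ∧ IsLevelZero (ofExpr x ≫ q) := by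
  induction x with
  | @hom A B f => exact ⟨B, 𝟙 B, .id B, by rw [Category.comp_id]; exact .ofHom f⟩
  | @cornerInv A c =>
    refine ⟨_, cornerHom c, .corner c, ?_⟩
    have e : ofExpr (Expr.cornerInv c) ≫ cornerHom c = 𝟙 (corner c) := cornerInv_hom c
    rw [e]
    exact .ofHom (GHom.id _)
  | @delta B M A S =>
    refine ⟨_, ofHom S.j, .ideal S, ?_⟩
    -- The relation Δ j + f s = 1 shows that j clears Δ. The difference explains why level 0 must
    -- contain sums and negatives of ring homomorphisms.
    have e : ofExpr (Expr.delta S) ≫ ofHom S.j = 𝟙 M + -(ofHom (B := A) S.f ≫ ofHom S.s) :=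
      eq_add_neg_of_add_eq (delta_j S).symm
    rw [e]
    exact .add (.ofHom (GHom.id _)) (.neg (.comp (.ofHom _) (.ofHom _)))
  | @comp A B C x y i₁ i₂ =>
    obtain ⟨B₁, q₁, hq₁, hx⟩ := i₁
    obtain ⟨C₁, q₂, hq₂, hy⟩ := i₂
    -- The denominator q₁ of x is moved past the level-0 morphism y q₂, which gives x y q₂ q = (x
    -- q₁) h.
    obtain ⟨C', q, h, hq, hh, e⟩ := hy.exists_square hq₁
    refine ⟨C', q₂ ≫ q, .comp hq₂ hq, ?_⟩
    have e' : ofExpr (x.comp y) ≫ q₂ ≫ q = (ofExpr x ≫ q₁) ≫ h := by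
      show (ofExpr x ≫ ofExpr y) ≫ q₂ ≫ q = _
      rw [Category.assoc, ← Category.assoc (ofExpr y), e, Category.assoc]
    rw [e']
    exact .comp hx hh
  | @zero A B =>
    refine ⟨B, 𝟙 B, .id B, ?_⟩
    rw [Category.comp_id]
    exact .zero
  | @add A B x y i₁ i₂ =>
    obtain ⟨B₁, q₁, hq₁, hx⟩ := i₁
    obtain ⟨B₂, q₂, hq₂, hy⟩ := i₂
    obtain ⟨B', r₁, r₂, hr₁, hr₂, hr, e⟩ := hq₁.exists_common hq₂
    refine ⟨B', q₁ ≫ r₁, hr, ?_⟩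
    have e' : ofExpr (x.add y) ≫ q₁ ≫ r₁ = (ofExpr x ≫ q₁) ≫ r₁ + (ofExpr y ≫ q₂) ≫ r₂ := by
      show (ofExpr x + ofExpr y) ≫ q₁ ≫ r₁ = _
      rw [Preadditive.add_comp, Category.assoc, Category.assoc, e]
    rw [e']
    exact .add (.comp hx hr₁) (.comp hy hr₂)
  | @neg A B x i =>
    obtain ⟨B', q, hq, hx⟩ := i
    refine ⟨B', q, hq, ?_⟩
    have e : ofExpr x.neg ≫ q = -(ofExpr x ≫ q) := Preadditive.neg_comp (ofExpr x) q
    exact e ▸ .neg hx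

/-- A functor is faithful if it is so on level-0 morphisms. -/
theorem map_injective_of_levelZero {D : Type u₁} [Category.{v₁} D] (F : GK 𝓡 ⥤ D)
    (hF : ∀ {A B : GK 𝓡} (x y : A ⟶ B), IsLevelZero x → IsLevelZero y →
      F.map x = F.map y → x = y) {A B : GK 𝓡} (x y : A ⟶ B) (h : F.map x = F.map y) : x = y := by
  obtain ⟨x, rfl⟩ := Quot.exists_rep x
  obtain ⟨y, rfl⟩ := Quot.exists_rep y
  obtain ⟨B₁, q₁, hq₁, hx⟩ := exists_isLevelZero_comp x
  obtain ⟨B₂, q₂, hq₂, hy⟩ := exists_isLevelZero_comp y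
  obtain ⟨B', r₁, r₂, hr₁, hr₂, hr, e⟩ := hq₁.exists_common hq₂
  have := hr.mono
  -- Both x and y are of level 0 after composition with q₁ r₁ = q₂ r₂, and this common denominator
  -- is a monomorphism.
  rw [← cancel_mono (q₁ ≫ r₁)]
  refine hF _ _ ?_ ?_ (by rw [F.map_comp, h, ← F.map_comp])
  · rw [← Category.assoc]
    exact .comp hx hr₁
  · rw [e, ← Category.assoc]
    exact .comp hy hr₂

end GK

end GKTheory

theorem theorem108 {G : Type w} [Group G] (𝓡 : GKTheory.RingClass.{w, u} G)
    {D : Type u₁} [Category.{v₁} D] (F : GKTheory.GK 𝓡 ⥤ D) :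
    F.Faithful ↔ (GKTheory.GK.inclusionL0 𝓡 ⋙ F).Faithful := by
  constructor
  · intro _
    have : (GKTheory.GK.inclusionL0 𝓡).Faithful :=
      inferInstanceAs (wideSubcategoryInclusion (GKTheory.GK.levelZero 𝓡)).Faithful
    infer_instance
  · intro hF
    refine ⟨fun {A B} x y h => GKTheory.GK.map_injective_of_levelZero F ?_ x y h⟩
    intro A B x y hx hy hxy
    have := hF.map_injective (X := (⟨A⟩ : GKTheory.GK.L0 𝓡)) (Y := ⟨B⟩)
      (a₁ := ⟨x, hx⟩) (a₂ := ⟨y, hy⟩) hxy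
    exact congrArg (fun f => f.1) this
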